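/- Let $\mathbb N=\{0,1,2,\dots\}$ and let $\Bbbk$ be a field. A numerical semigroup is a subset $S\subseteq\mathbb N$ containing $0$, closed under addition, with finite complement. Let $g_1<\dots<g_\nu$ be its minimal generators, i.e. the nonzero elements of $S$ that are not sums of two nonzero elements of $S$; thus $m=g_1$ is the least positive element of $S$. For $n\in S$ put $\mathrm{Ap}(S,n)=\{s\in S : s-n\notin S\}$, and $\mathrm{Ap}(S)=\mathrm{Ap}(S,m)$. A representation of $s\in S$ is a vector $\lambda\in\mathbb N^\nu$ with $s=\sum_i\lambda_ig_i$; $\mathrm{ord}(s)$ is the maximum of $\sum_i\lambda_i$ over all representations of $s$, and a representation attaining this maximum is called maximal. Write $\langle A\rangle$ for the additive submonoid of $\mathbb N$ generated by $A$. For $2\le i\le\nu$ let $$\begin{aligned} \tau_i&=\min\{h\ge 1 : hg_i\in\langle g_1,\dots,g_{i-1}\rangle\}-1,\\ \alpha_i&=\max\{h\ge 0 : hg_i\in \mathrm{Ap}(S)\},\\ \beta_i&=\max\{h\ge 0 : hg_i\in \mathrm{Ap}(S),\ \mathrm{ord}(hg_i)=h\},\\ \gamma_i&=\max\{h\ge 0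 : hg_i\in \mathrm{Ap}(S),\ \mathrm{ord}(hg_i)=h,\ hg_i \text{ has a unique maximal representation}\}. \end{aligned}$$ For a rearrangement $\mathbf n=(n_1,\dots,n_\nu)$ of the minimal generators and $2\le i\le \nu$ let $\phi_i=\min\{h\ge 1 : hn_i\in\langle n_1,\dots,n_{i-1}\rangle\}-1$. Consider the following conditions on $S$: 1. $S$ is associated to a plane branch: $S$ is telescopic (condition 3) and $(\tau_i+1)g_i<g_{i+1}$ for $2\le i\le\nu-1$. 2. $S$ has a unique Betti element: all minimal first syzygies of the semigroup ring of $S$ over $\Bbbk$ have the same degree. That is, if $I$ is the kernel of $\Bbbk[x_1,\dots,x_\nu]\to\Bbbk[t]$, $x_i\mapsto t^{g_i}$, graded by $\deg x_i=g_i$, then all elements of minimal homogeneous generating sets of $I$ have the same degree (this holds vacuously for $S=\mathbb N$). 3. $S$ is telescopic: $\mathrm{Ap}(S)=\{\sum_{i=2}^\nu\lambda_ig_i : 0\le\lambda_i\le\tau_i\}$. 4. $S$ has $\alpha$-rectangular Apéry set: $\mathrm{Ap}(S)=\{\sum_{i=2}^\nu\lambda_ig_i : 0\le\lambda_i\le\alpha_i\}$.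 5. $S$ has $\beta$-rectangular Apéry set: $\mathrm{Ap}(S)=\{\sum_{i=2}^\nu\lambda_ig_i : 0\le\lambda_i\le\beta_i\}$. 6. $S$ has $\gamma$-rectangular Apéry set: $\mathrm{Ap}(S)=\{\sum_{i=2}^\nu\lambda_ig_i : 0\le\lambda_i\le\gamma_i\}$. 7. $S$ is free: for some rearrangement $\mathbf n$ of the minimal generators, $\mathrm{Ap}(S,n_1)=\{\sum_{i=2}^\nu\lambda_in_i : 0\le\lambda_i\le\phi_i\}$. 8. $S$ is a complete intersection: every minimal presentation of $S$ (an inclusion-minimal generating set of the congruence $\{(a,b)\in\mathbb N^\nu\times\mathbb N^\nu : \sum_i a_ig_i=\sum_i b_ig_i\}$; such sets exist) has exactly $\nu-1$ elements. Then for every numerical semigroup $S$: $(1)\Rightarrow(3)\Rightarrow(5)$, $(2)\Rightarrow(4)\Rightarrow(5)$, $(1)\Rightarrow(4)$, $(2)\Rightarrow(3)$, and $(5)\Rightarrow(6)\Rightarrow(7)\Rightarrow(8)$. Moreover, each of these nine implications is strict: for each implication $(a)\Rightarrow(b)$ in the list there is a numerical semigroup satisfying $(b)$ but not $(a)$. 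-/

import Mathlib

/-- A numerical semigroup: a submonoid of `(ℕ, +)` with finite complement in `ℕ`. -/
structure NumericalSemigroup extends AddSubmonoid ℕ where
  finite_compl : (carrierᶜ : Set ℕ).Finite

namespace NumericalSemigroup

instance : SetLike NumericalSemigroup ℕ where
  coe S := S.carrier
  coe_injective := by
    rintro ⟨S, hS⟩ ⟨T, hT⟩ h
    have h' : S = T := SetLike.coe_injective h
    subst h'
    rfl

/-- The partial order on a numerical semigroup: `s ⪯ t` if `t = u + s` for some `u ∈ S`. -/
def Prec (S : NumericalSemigroup) (s t : ℕ) : Prop := ∃ u ∈ S, t = u + s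

/-- The minimal system of generators: the minimal elements of `(S \ {0}, ⪯)`. -/
def minGens (S : NumericalSemigroup) : Set ℕ :=
  {s | s ∈ S ∧ s ≠ 0 ∧ ∀ t ∈ S, t ≠ 0 → S.Prec t s → t = s}

/-- The embedding dimension `ν(S)`. -/
noncomputable def embDim (S : NumericalSemigroup) : ℕ := S.minGens.ncard

/-- The multiplicity `m(S)`: the smallest positive element. It is the smallest minimal
generator `g₁`. -/
noncomputable def multiplicity (S : NumericalSemigroup) : ℕ := sInf {s | s ∈ S ∧ 0 < s}

/-- The Apéry set `Ap(S, n) = {s ∈ S | s - n ∉ S}` (integer subtraction). -/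
def aperyAt (S : NumericalSemigroup) (n : ℕ) : Set ℕ :=
  {s | s ∈ S ∧ ¬ ∃ t ∈ S, t + n = s}

/-- The Apéry set with respect to the multiplicity. -/
noncomputable def apery (S : NumericalSemigroup) : Set ℕ := S.aperyAt S.multiplicity

/-- The evaluation homomorphism `λ ↦ ∑ λ_g g`, from coefficient vectors indexed by the minimal
generators. The vector `a` is a representation of `s` when `S.eval a = s`. -/
noncomputable def eval (S : NumericalSemigroup) : (S.minGens →₀ ℕ) →+ ℕ :=
  Finsupp.weight (fun g : S.minGens => (g : ℕ))

/-- The `M`-adic order: the largest `∑ λ_g` over all representations of `s`. -/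
noncomputable def ord (S : NumericalSemigroup) (s : ℕ) : ℕ :=
  sSup {d | ∃ a : S.minGens →₀ ℕ, S.eval a = s ∧ a.degree = d}

/-- `s` has exactly one maximal representation. -/
def HasUniqueMaxRep (S : NumericalSemigroup) (s : ℕ) : Prop :=
  ∃! a : S.minGens →₀ ℕ, S.eval a = s ∧ a.degree = S.ord s

/-! The integers `τ, α, β, γ` are indexed by the minimal generators themselves; the generators
preceding `g` in the increasing enumeration are those smaller than `g`. -/

/-- `τ_g`: the least `h ≥ 1` such that `h g` lies in the monoid generated by the minimal
generators smaller than `g`, minus one. -/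
noncomputable def tau (S : NumericalSemigroup) (g : ℕ) : ℕ :=
  sInf {h | 0 < h ∧ h * g ∈ AddSubmonoid.closure {x | x ∈ S.minGens ∧ x < g}} - 1

noncomputable def alpha (S : NumericalSemigroup) (g : ℕ) : ℕ :=
  sSup {h | h * g ∈ S.apery}

noncomputable def beta (S : NumericalSemigroup) (g : ℕ) : ℕ :=
  sSup {h | h * g ∈ S.apery ∧ S.ord (h * g) = h}

noncomputable def gamma (S : NumericalSemigroup) (g : ℕ) : ℕ :=
  sSup {h | h * g ∈ S.apery ∧ S.ord (h * g) = h ∧ S.HasUniqueMaxRep (h * g)}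

/-- The set `{∑_{i ≥ 2} λ_i g_i | 0 ≤ λ_i ≤ c(g_i)}`; the coefficient of the smallest generator
`g₁` is zero. -/
def box (S : NumericalSemigroup) (c : ℕ → ℕ) : Set ℕ :=
  {s | ∃ a : S.minGens →₀ ℕ, S.eval a = s ∧
    ∀ g : S.minGens, ((g : ℕ) = S.multiplicity → a g = 0) ∧
      ((g : ℕ) ≠ S.multiplicity → a g ≤ c g)}

def IsTelescopic (S : NumericalSemigroup) : Prop := S.apery = S.box S.tau

/-- Telescopic, and `(τ_i + 1) g_i < g_{i+1}` for `2 ≤ i ≤ ν - 1`: here `g` and `g'` are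
consecutive minimal generators and `g` is not the smallest one. -/
def IsPlaneBranch (S : NumericalSemigroup) : Prop :=
  S.IsTelescopic ∧ ∀ g ∈ S.minGens, ∀ g' ∈ S.minGens, g ≠ S.multiplicity → g < g' →
    (∀ x ∈ S.minGens, ¬ (g < x ∧ x < g')) → (S.tau g + 1) * g < g'

def IsAlphaRectangular (S : NumericalSemigroup) : Prop := S.apery = S.box S.alpha

def IsBetaRectangular (S : NumericalSemigroup) : Prop := S.apery = S.box S.beta

def IsGammaRectangular (S : NumericalSemigroup) : Prop := S.apery = S.box S.gamma

/-- For a sequence `n 1, n 2, …`: the least `h ≥ 1` such that `h * n i` lies in the monoid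
generated by `n 1, …, n (i - 1)`, minus one. -/
noncomputable def phi (n : ℕ → ℕ) (i : ℕ) : ℕ :=
  sInf {h | 0 < h ∧ h * n i ∈ AddSubmonoid.closure (n '' Set.Ico 1 i)} - 1

/-- `n 1, …, n ν` is a rearrangement of the minimal generators. -/
def IsFree (S : NumericalSemigroup) : Prop :=
  ∃ n : ℕ → ℕ, Set.BijOn n (Set.Icc 1 S.embDim) S.minGens ∧
    S.aperyAt (n 1) =
      {s | ∃ l : ℕ → ℕ, (∀ i ∈ Finset.Icc 2 S.embDim, l i ≤ phi n i) ∧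
        s = ∑ i ∈ Finset.Icc 2 S.embDim, l i * n i}

/-- A presentation of `S`: a set of pairs of coefficient vectors that generates the kernel
congruence of the evaluation homomorphism. -/
def IsPresentation (S : NumericalSemigroup)
    (ρ : Set ((S.minGens →₀ ℕ) × (S.minGens →₀ ℕ))) : Prop :=
  addConGen (fun a b => (a, b) ∈ ρ) = AddCon.ker S.eval

/-- A presentation none of whose proper subsets is a presentation. -/
def IsMinimalPresentation (S : NumericalSemigroup)
    (ρ : Set ((S.minGens →₀ ℕ) × (S.minGens →₀ ℕ))) : Prop :=
  Minimal S.IsPresentation ρ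

/-- Minimal presentations exist and every one of them has cardinality `ν - 1`. -/
def IsCompleteIntersection (S : NumericalSemigroup) : Prop :=
  (∃ ρ, S.IsMinimalPresentation ρ) ∧
    ∀ ρ, S.IsMinimalPresentation ρ → ρ.encard + 1 = (S.embDim : ℕ∞)

/-- The defining ideal of the semigroup ring `k[t^S]`: the kernel of the map `x_g ↦ t^g` from the
polynomial ring with one variable for each minimal generator. -/
noncomputable def definingIdeal (S : NumericalSemigroup) (k : Type*) [Field k] :
    Ideal (MvPolynomial S.minGens k) :=
  RingHom.ker (MvPolynomial.aeval (R := k)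
    (fun g : S.minGens => (Polynomial.X : Polynomial k) ^ (g : ℕ)))

/-- The degrees of the (minimal) first syzygies of the semigroup ring in the grading where `x_g`
has degree `g`: the `n` such that the degree `n` part of `I / 𝔪 I` is nonzero, where `I` is the
defining ideal and `𝔪` is generated by the variables. These are the degrees of the elements of a
minimal homogeneous generating set of `I`. -/
def firstSyzygyDegrees (S : NumericalSemigroup) (k : Type*) [Field k] : Set ℕ :=
  {n | ∃ f ∈ S.definingIdeal k,
    MvPolynomial.IsWeightedHomogeneous (fun g : S.minGens => (g : ℕ)) f n ∧
      f ∉ Ideal.span (Set.range (MvPolynomial.X (R := k))) * S.definingIdeal k}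

/-- All first syzygies have the same degree. -/
def HasUniqueBettiElement (S : NumericalSemigroup) (k : Type*) [Field k] : Prop :=
  (S.firstSyzygyDegrees k).Subsingleton

end NumericalSemigroup

/-! ### Minimal generators, Apéry sets and representations -/

namespace NumericalSemigroup

/-! The first implications rest on a chain of inclusions valid for every numerical semigroup: the
Apéry set lies in the `γ`-box, which lies in the `β`-box, which lies in both the `α`-box and the
`τ`-box. Equality with a larger box therefore forces equality with every smaller one. The inclusion
in the `γ`-box comes from ordering representations by degree and then by `∑ a_j j²`. This order is
invariant under translation. A multiple `h g` with `h > γ_g` can be rewritten either with `g₁` or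
with larger rank, so a rank-maximal representation of an Apéry element stays in the box
(`apery_subset_box_gamma`).

For plane branches the growth condition gives `α ≤ τ`. With a unique Betti element `B`, the least
multiple `c_g g` of each generator lying in the monoid of the others equals `B`. Vectors with all
coordinates below `c_g` are then the only representations of their values, so the `α`- and `τ`-boxes
lie in the Apéry set.

For `γ`-rectangular implies free, fix such a rewriting of each `(γ_g + 1) g`. A cycle among the
rewritings would, after summation and cancellation, contradict the rank-maximality of vectors in the
`γ`-box. The generators can therefore be ordered so that each rewriting uses only earlier ones,
which gives `φ ≤ γ`.

A free semigroup is presented by the `ν - 1` relations rewriting `(φ_i + 1) n_i`, since they lead to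
unique normal forms (`IsFree.exists_normalForms`). No presentation is smaller, by a rank count over
`ℚ`. No minimal presentation is larger than another presentation, because its binomials are linearly
independent modulo those whose terms share a variable, a Nakayama-type statement.

Strictness is witnessed by explicit semigroups. Non-freeness of `⟨10, 14, 15, 21⟩` uses that the
last generator of a free semigroup is never in the group generated by the others. -/

instance : AddSubmonoidClass NumericalSemigroup ℕ where
  zero_mem S := S.toAddSubmonoid.zero_mem
  add_mem {S} _ _ ha hb := S.toAddSubmonoid.add_mem ha hb

variable {S : NumericalSemigroup}

lemma finite_notMem (S : NumericalSemigroup) : {n : ℕ | n ∉ S}.Finite := S.finite_compl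

lemma exists_forall_ge_mem (S : NumericalSemigroup) : ∃ N : ℕ, ∀ n, N ≤ n → n ∈ S := by
  obtain ⟨N, hN⟩ := S.finite_notMem.bddAbove
  refine ⟨N + 1, fun n hn => ?_⟩
  by_contra h
  have : n ≤ N := hN h
  omega

lemma multiplicity_spec (S : NumericalSemigroup) : S.multiplicity ∈ S ∧ 0 < S.multiplicity := by
  obtain ⟨N, hN⟩ := S.exists_forall_ge_mem
  exact Nat.sInf_mem (s := {s | s ∈ S ∧ 0 < s}) ⟨N + 1, hN _ (by omega), by omega⟩

lemma multiplicity_mem (S : NumericalSemigroup) : S.multiplicity ∈ S := S.multiplicity_spec.1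

lemma multiplicity_pos (S : NumericalSemigroup) : 0 < S.multiplicity := S.multiplicity_spec.2

lemma multiplicity_le {s : ℕ} (hs : s ∈ S) (h0 : s ≠ 0) : S.multiplicity ≤ s :=
  Nat.sInf_le ⟨hs, Nat.pos_of_ne_zero h0⟩

lemma mem_of_mem_minGens {g : ℕ} (hg : g ∈ S.minGens) : g ∈ S := hg.1

lemma pos_of_mem_minGens {g : ℕ} (hg : g ∈ S.minGens) : 0 < g := Nat.pos_of_ne_zero hg.2.1

lemma multiplicity_mem_minGens (S : NumericalSemigroup) : S.multiplicity ∈ S.minGens := by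
  refine ⟨S.multiplicity_mem, S.multiplicity_pos.ne', ?_⟩
  rintro t ht h0 ⟨u, -, h⟩
  have := multiplicity_le ht h0
  omega

lemma aperyAt_finite (S : NumericalSemigroup) (n : ℕ) : (S.aperyAt n).Finite := by
  obtain ⟨N, hN⟩ := S.exists_forall_ge_mem
  refine (Set.finite_Iio (N + n)).subset ?_
  rintro s ⟨-, hs⟩
  by_contra h
  rw [Set.mem_Iio, not_lt] at h
  exact hs ⟨s - n, hN _ (by omega), by omega⟩

lemma apery_finite (S : NumericalSemigroup) : S.apery.Finite := S.aperyAt_finite _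

lemma zero_mem_aperyAt {n : ℕ} (hn : 0 < n) : 0 ∈ S.aperyAt n :=
  ⟨zero_mem S, by rintro ⟨t, -, ht⟩; omega⟩

lemma zero_mem_apery (S : NumericalSemigroup) : 0 ∈ S.apery :=
  zero_mem_aperyAt S.multiplicity_pos

lemma left_mem_aperyAt {n s t : ℕ} (hs : s ∈ S) (ht : t ∈ S) (h : s + t ∈ S.aperyAt n) :
    s ∈ S.aperyAt n := by
  refine ⟨hs, ?_⟩
  rintro ⟨u, hu, rfl⟩
  exact h.2 ⟨u + t, add_mem hu ht, by ring⟩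

lemma mem_apery_of_mem_minGens {g : ℕ} (hg : g ∈ S.minGens) (h : g ≠ S.multiplicity) :
    g ∈ S.apery := by
  refine ⟨hg.1, ?_⟩
  rintro ⟨t, ht, e⟩
  exact h (hg.2.2 _ S.multiplicity_mem S.multiplicity_pos.ne' ⟨t, ht, e.symm⟩).symm

lemma minGens_finite (S : NumericalSemigroup) : S.minGens.Finite := by
  refine (S.apery_finite.insert S.multiplicity).subset fun g hg => ?_
  by_cases h : g = S.multiplicity
  · exact Or.inl h
  · exact Or.inr (mem_apery_of_mem_minGens hg h)

instance : Finite S.minGens := S.minGens_finite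

/-- The smallest minimal generator, as an element of the index type. -/
noncomputable def fst (S : NumericalSemigroup) : S.minGens := ⟨_, S.multiplicity_mem_minGens⟩

lemma coe_eq_multiplicity_iff {g : S.minGens} : (g : ℕ) = S.multiplicity ↔ g = S.fst :=
  ⟨fun h => Subtype.ext h, fun h => by rw [h]; rfl⟩

@[simp] lemma coe_fst : (S.fst : ℕ) = S.multiplicity := rfl

lemma gen_pos (g : S.minGens) : 0 < (g : ℕ) := pos_of_mem_minGens g.2

@[simp] lemma eval_single (g : S.minGens) (n : ℕ) :
    S.eval (Finsupp.single g n) = n * (g : ℕ) := by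
  simp [eval, Finsupp.weight_apply]

lemma eval_mem (a : S.minGens →₀ ℕ) : S.eval a ∈ S := by
  induction a using Finsupp.induction_linear with
  | zero => simp
  | add a b ha hb => rw [map_add]; exact add_mem ha hb
  | single g n => simpa using nsmul_mem (mem_of_mem_minGens g.2) n

lemma exists_eval_eq {s : ℕ} (hs : s ∈ S) : ∃ a, S.eval a = s := by
  induction s using Nat.strong_induction_on with
  | _ s ih =>
    by_cases h0 : s = 0
    · exact ⟨0, by simp [h0]⟩
    by_cases hg : s ∈ S.minGens
    · exact ⟨Finsupp.single ⟨s, hg⟩ 1, by simp⟩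
    · have : ∃ t ∈ S, t ≠ 0 ∧ S.Prec t s ∧ t ≠ s := by
        by_contra! h
        exact hg ⟨hs, h0, h⟩
      obtain ⟨t, ht, ht0, ⟨u, hu, rfl⟩, hne⟩ := this
      obtain ⟨a, ha⟩ := ih t (by omega) ht
      obtain ⟨b, hb⟩ := ih u (by omega) hu
      exact ⟨b + a, by rw [map_add, ha, hb]⟩

lemma eval_eq_zero_iff {a : S.minGens →₀ ℕ} : S.eval a = 0 ↔ a = 0 := by
  refine ⟨fun h => ?_, fun h => by simp [h]⟩
  by_contra h0
  obtain ⟨g, hg⟩ := Finsupp.ne_iff.1 h0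
  rw [Finsupp.zero_apply] at hg
  have hle : Finsupp.single g 1 ≤ a := by
    rw [Finsupp.single_le_iff]; omega
  have := congrArg S.eval (tsub_add_cancel_of_le hle)
  rw [map_add, eval_single, h] at this
  have := gen_pos g
  omega

lemma degree_le_eval (a : S.minGens →₀ ℕ) : a.degree ≤ S.eval a := by
  induction a using Finsupp.induction_linear with
  | zero => simp
  | add a b ha hb => rw [map_add, map_add]; omega
  | single g n =>
    rw [eval_single, Finsupp.degree_single]
    exact Nat.le_mul_of_pos_right _ (gen_pos g)

lemma finite_reps (S : NumericalSemigroup) (s : ℕ) : {a | S.eval a = s}.Finite := by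
  refine (Finsupp.finite_of_degree_le (σ := S.minGens) s).subset ?_
  rintro a rfl
  exact degree_le_eval a

lemma eval_mono {a b : S.minGens →₀ ℕ} (h : a ≤ b) : S.eval b = S.eval a + S.eval (b - a) := by
  rw [← map_add, add_tsub_cancel_of_le h]

lemma eval_mem_aperyAt_of_le {n : ℕ} {a b : S.minGens →₀ ℕ} (h : a ≤ b)
    (hb : S.eval b ∈ S.aperyAt n) : S.eval a ∈ S.aperyAt n := by
  rw [eval_mono h] at hb
  exact left_mem_aperyAt (eval_mem _) (eval_mem _) hb

lemma apply_eq_zero_of_eval_mem_aperyAt {g : S.minGens} {a : S.minGens →₀ ℕ}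
    (h : S.eval a ∈ S.aperyAt g) : a g = 0 := by
  by_contra h0
  have hle : Finsupp.single g 1 ≤ a := by
    rw [Finsupp.single_le_iff]; omega
  refine h.2 ⟨S.eval (a - Finsupp.single g 1), eval_mem _, ?_⟩
  rw [eval_mono hle, eval_single]; ring

lemma exists_eval_of_notMem_aperyAt {g : S.minGens} {s : ℕ} (hs : s ∈ S)
    (h : s ∉ S.aperyAt g) : ∃ a, S.eval a = s ∧ a g ≠ 0 := by
  have : ∃ t ∈ S, t + g = s := by
    by_contra hc
    exact h ⟨hs, hc⟩
  obtain ⟨t, ht, rfl⟩ := this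
  obtain ⟨a, rfl⟩ := exists_eval_eq ht
  exact ⟨a + Finsupp.single g 1, by simp, by simp⟩

lemma bddAbove_degrees (S : NumericalSemigroup) (s : ℕ) :
    BddAbove {d | ∃ a, S.eval a = s ∧ a.degree = d} := by
  refine ⟨s, ?_⟩
  rintro d ⟨a, rfl, rfl⟩
  exact degree_le_eval a

lemma degree_le_ord (a : S.minGens →₀ ℕ) : a.degree ≤ S.ord (S.eval a) :=
  le_csSup (S.bddAbove_degrees _) ⟨a, rfl, rfl⟩

lemma ord_le {s d : ℕ} (h : ∀ a, S.eval a = s → a.degree ≤ d) : S.ord s ≤ d := by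
  unfold ord
  by_cases hs : s ∈ S
  · obtain ⟨a, ha⟩ := exists_eval_eq hs
    refine csSup_le ⟨_, a, ha, rfl⟩ ?_
    rintro e ⟨b, hb, rfl⟩
    exact h b hb
  -- Outside `S` there are no representations, and the supremum of the empty set of naturals is `0`.
  · rw [show {d | ∃ a, S.eval a = s ∧ a.degree = d} = ∅ from ?_]
    · simp
    · ext d
      simp only [Set.mem_ofPred_eq, Set.mem_empty_iff_false, iff_false]
      rintro ⟨a, rfl, -⟩
      exact hs (eval_mem a)

/-- Translates the submonoids occurring in `tau` and `phi` into exponent vectors with restricted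
support. -/
lemma mem_closure_iff_exists_eval {T : Set ℕ} (hT : T ⊆ S.minGens) {y : ℕ} :
    y ∈ AddSubmonoid.closure T ↔
      ∃ a, S.eval a = y ∧ ∀ g : S.minGens, a g ≠ 0 → (g : ℕ) ∈ T := by
  constructor
  · intro hy
    induction hy using AddSubmonoid.closure_induction with
    | mem x hx =>
      refine ⟨Finsupp.single ⟨x, hT hx⟩ 1, by simp, fun g hg => ?_⟩
      rw [Finsupp.single_apply_ne_zero] at hg
      rw [hg.1]; exact hx
    | zero => exact ⟨0, by simp, by simp⟩
    | add x y _ _ hx hy =>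
      obtain ⟨a, rfl, ha⟩ := hx
      obtain ⟨b, rfl, hb⟩ := hy
      refine ⟨a + b, map_add _ _ _, fun g hg => ?_⟩
      rw [Finsupp.add_apply] at hg
      by_cases h : a g = 0
      · exact hb g (by omega)
      · exact ha g h
  · rintro ⟨a, rfl, ha⟩
    induction a using Finsupp.induction with
    | zero => simp
    | single_add g n a hga hn ih =>
      rw [map_add, eval_single]
      refine add_mem ?_ (ih fun g' hg' => ha g' ?_)
      · refine nsmul_mem (AddSubmonoid.subset_closure (ha g ?_)) n
        simp; omega
      · simp; omega

end NumericalSemigroup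

/-! ### Rank-maximal representations and the inclusions between the boxes -/

namespace NumericalSemigroup

variable {S : NumericalSemigroup}

lemma exists_degree_eq_ord {s : ℕ} (hs : s ∈ S) : ∃ a, S.eval a = s ∧ a.degree = S.ord s := by
  obtain ⟨a, ha⟩ := exists_eval_eq hs
  exact Nat.sSup_mem (s := {d | ∃ a, S.eval a = s ∧ a.degree = d}) ⟨_, a, ha, rfl⟩
    (S.bddAbove_degrees s)

/-- The weight giving each variable the square of the corresponding generator. -/
noncomputable def sqEval (S : NumericalSemigroup) : (S.minGens →₀ ℕ) →+ ℕ :=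
  Finsupp.weight (fun g : S.minGens => (g : ℕ) ^ 2)

@[simp] lemma sqEval_single (g : S.minGens) (n : ℕ) :
    S.sqEval (Finsupp.single g n) = n * (g : ℕ) ^ 2 := by
  simp [sqEval, Finsupp.weight_apply]

/-- This is `∑ a_j (g - j)² ≥ 0`, expanded so as to avoid subtraction. It is strict as soon as some
`j ≠ g` occurs. -/
lemma two_mul_eval_le (g : S.minGens) (a : S.minGens →₀ ℕ) :
    2 * (g : ℕ) * S.eval a ≤ S.sqEval a + (g : ℕ) ^ 2 * a.degree := by
  induction a using Finsupp.induction_linear with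
  | zero => simp
  | add a b ha hb => simp only [map_add, mul_add]; omega
  | single j n =>
    rw [eval_single, sqEval_single, Finsupp.degree_single]
    have : 2 * (g : ℕ) * j ≤ (j : ℕ) ^ 2 + (g : ℕ) ^ 2 := by
      zify; nlinarith [sq_nonneg ((g : ℤ) - j)]
    nlinarith [Nat.mul_le_mul_left n this]

lemma two_mul_eval_lt {g j : S.minGens} (hj : j ≠ g) {a : S.minGens →₀ ℕ} (ha : a j ≠ 0) :
    2 * (g : ℕ) * S.eval a < S.sqEval a + (g : ℕ) ^ 2 * a.degree := by
  have hle : Finsupp.single j 1 ≤ a := by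
    rw [Finsupp.single_le_iff]; omega
  obtain ⟨b, rfl⟩ := exists_add_of_le hle
  have h1 := two_mul_eval_le g b
  have h2 : 2 * (g : ℕ) * j < (j : ℕ) ^ 2 + (g : ℕ) ^ 2 := by
    have : (g : ℤ) - j ≠ 0 := by
      intro h
      exact hj (Subtype.ext (by omega))
    have := pow_pos (abs_pos.2 this) 2
    rw [sq_abs] at this
    zify; nlinarith
  simp only [map_add, mul_add, eval_single, sqEval_single, Finsupp.degree_single, one_mul, mul_one]
  omega

/-- With value and degree fixed, the sum of squares is least when all summands are equal. This turns
a second maximal representation of `h g` into one of strictly larger rank. -/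
lemma sqEval_lt_of_ne_single {g : S.minGens} {h : ℕ} {a : S.minGens →₀ ℕ}
    (he : S.eval a = h * g) (hd : a.degree = h) (hne : a ≠ Finsupp.single g h) :
    h * (g : ℕ) ^ 2 < S.sqEval a := by
  have : ∃ j, j ≠ g ∧ a j ≠ 0 := by
    by_contra! hc
    apply hne
    have : a = Finsupp.single g (a g) := by
      ext j
      by_cases hj : j = g
      · simp [hj]
      · rw [hc j hj, Finsupp.single_apply, if_neg (Ne.symm hj)]
    rw [this, Finsupp.degree_single] at hd
    rw [this, hd]
  obtain ⟨j, hj, haj⟩ := this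
  have h1 := two_mul_eval_lt hj haj
  rw [he, hd] at h1
  nlinarith

/-- Comparison of representations by degree and then by `sqEval`. -/
noncomputable def rank (a : S.minGens →₀ ℕ) : ℕ ×ₗ ℕ := toLex (a.degree, S.sqEval a)

lemma rank_lt_rank_iff {a b : S.minGens →₀ ℕ} :
    rank a < rank b ↔ a.degree < b.degree ∨ a.degree = b.degree ∧ S.sqEval a < S.sqEval b := by
  simp [rank, Prod.Lex.toLex_lt_toLex]

lemma rank_add_lt_rank_add_iff {a b c : S.minGens →₀ ℕ} :
    rank (a + c) < rank (b + c) ↔ rank a < rank b := by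
  simp [rank_lt_rank_iff]

lemma exists_rank_maximal {s : ℕ} (hs : s ∈ S) :
    ∃ a, S.eval a = s ∧ ∀ b, S.eval b = s → ¬ rank a < rank b := by
  obtain ⟨a, ha⟩ := (S.finite_reps s).exists_maximalFor rank _ (exists_eval_eq hs)
  exact ⟨a, ha.1, fun b hb hlt => (ha.2 hb hlt.le).not_gt hlt⟩

/-- Since rank comparison is translation invariant, improving a part would improve the whole. -/
lemma rank_maximal_of_le {a b : S.minGens →₀ ℕ} (hab : a ≤ b)
    (h : ∀ c, S.eval c = S.eval b → ¬ rank b < rank c) :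
    ∀ c, S.eval c = S.eval a → ¬ rank a < rank c := by
  intro c hc hlt
  obtain ⟨d, rfl⟩ := exists_add_of_le hab
  refine h (c + d) (by simp [hc]) (rank_add_lt_rank_add_iff.2 hlt)

lemma bddAbove_alpha {g : ℕ} (hg : 0 < g) : BddAbove {h | h * g ∈ S.apery} := by
  obtain ⟨N, hN⟩ := S.apery_finite.bddAbove
  exact ⟨N, fun h hh => (Nat.le_mul_of_pos_right h hg).trans (hN hh)⟩

lemma bddAbove_beta {g : ℕ} (hg : 0 < g) :
    BddAbove {h | h * g ∈ S.apery ∧ S.ord (h * g) = h} :=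
  (bddAbove_alpha (S := S) hg).mono fun _ h => h.1

lemma bddAbove_gamma {g : ℕ} (hg : 0 < g) :
    BddAbove {h | h * g ∈ S.apery ∧ S.ord (h * g) = h ∧ S.HasUniqueMaxRep (h * g)} :=
  (bddAbove_alpha (S := S) hg).mono fun _ h => h.1

lemma ord_zero (S : NumericalSemigroup) : S.ord 0 = 0 := by
  refine Nat.le_zero.1 (ord_le fun a ha => ?_)
  rw [eval_eq_zero_iff.1 ha]; simp

lemma hasUniqueMaxRep_zero (S : NumericalSemigroup) : S.HasUniqueMaxRep 0 :=
  ⟨0, by simp [ord_zero], fun a ha => eval_eq_zero_iff.1 ha.1⟩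

lemma beta_le_alpha {g : ℕ} (hg : 0 < g) : S.beta g ≤ S.alpha g :=
  csSup_le_csSup (bddAbove_alpha hg) ⟨0, by simp [zero_mem_apery, ord_zero]⟩ fun _ h => h.1

lemma gamma_le_beta {g : ℕ} (hg : 0 < g) : S.gamma g ≤ S.beta g :=
  csSup_le_csSup (bddAbove_beta hg)
    ⟨0, by simp [zero_mem_apery, ord_zero, hasUniqueMaxRep_zero]⟩ fun _ h => ⟨h.1, h.2.1⟩

lemma alpha_mul_mem_apery {g : ℕ} (hg : 0 < g) : S.alpha g * g ∈ S.apery :=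
  Nat.sSup_mem (s := {h | h * g ∈ S.apery}) ⟨0, by simp [zero_mem_apery]⟩ (bddAbove_alpha hg)

lemma beta_spec {g : ℕ} (hg : 0 < g) :
    S.beta g * g ∈ S.apery ∧ S.ord (S.beta g * g) = S.beta g :=
  Nat.sSup_mem (s := {h | h * g ∈ S.apery ∧ S.ord (h * g) = h})
    ⟨0, by simp [zero_mem_apery, ord_zero]⟩ (bddAbove_beta hg)

lemma gamma_spec {g : ℕ} (hg : 0 < g) :
    S.gamma g * g ∈ S.apery ∧ S.ord (S.gamma g * g) = S.gamma g ∧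
      S.HasUniqueMaxRep (S.gamma g * g) :=
  Nat.sSup_mem (s := {h | h * g ∈ S.apery ∧ S.ord (h * g) = h ∧ S.HasUniqueMaxRep (h * g)})
    ⟨0, by simp [zero_mem_apery, ord_zero, hasUniqueMaxRep_zero]⟩ (bddAbove_gamma hg)

/-- A multiple of `g` exceeding `γ_g g` has a representation that is either divisible by `g₁` or
of larger rank. -/
lemma exists_better_rep {g : S.minGens} {h : ℕ} (hh : S.gamma g < h) :
    ∃ u, S.eval u = h * g ∧ (u S.fst ≠ 0 ∨ rank (Finsupp.single g h) < rank u) := by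
  -- As `h` exceeds the supremum defining `γ_g`, one of the three defining conditions fails. Each
  -- failure supplies its own rewriting.
  by_cases hA : h * (g : ℕ) ∈ S.apery
  · by_cases ho : S.ord (h * g) = h
    · have hu : ¬ S.HasUniqueMaxRep (h * g) := fun hu =>
        (le_csSup (bddAbove_gamma (S := S) (gen_pos g)) ⟨hA, ho, hu⟩).not_gt hh
      have : ∃ u, S.eval u = h * g ∧ u.degree = h ∧ u ≠ Finsupp.single g h := by
        by_contra! hc
        exact hu ⟨Finsupp.single g h, by simp [ho], fun u hu => hc u hu.1 (hu.2.trans ho)⟩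
      obtain ⟨u, hu1, hu2, hu3⟩ := this
      refine ⟨u, hu1, Or.inr ?_⟩
      rw [rank_lt_rank_iff, Finsupp.degree_single, sqEval_single]
      exact Or.inr ⟨hu2.symm, sqEval_lt_of_ne_single hu1 hu2 hu3⟩
    · obtain ⟨u, hu1, hu2⟩ := exists_degree_eq_ord (s := h * g) hA.1
      refine ⟨u, hu1, Or.inr ?_⟩
      rw [rank_lt_rank_iff, Finsupp.degree_single, hu2]
      have := degree_le_ord (Finsupp.single g h)
      rw [Finsupp.degree_single, eval_single] at this
      exact Or.inl (by omega)
  · have hm : h * (g : ℕ) ∈ S := nsmul_mem (mem_of_mem_minGens g.2) h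
    obtain ⟨u, hu, hu0⟩ := exists_eval_of_notMem_aperyAt (g := S.fst) hm hA
    exact ⟨u, hu, Or.inl hu0⟩

/-- A coordinate above `γ_g` could be rewritten by `exists_better_rep`. Using `g₁` is impossible
inside an Apéry element, and a larger rank contradicts maximality. -/
lemma le_gamma_of_rank_maximal {a : S.minGens →₀ ℕ} (hA : S.eval a ∈ S.apery)
    (h : ∀ b, S.eval b = S.eval a → ¬ rank a < rank b) (g : S.minGens) : a g ≤ S.gamma g := by
  by_contra! hlt
  obtain ⟨u, hu, hu'⟩ := exists_better_rep hlt
  have hle : Finsupp.single g (a g) ≤ a := by rw [Finsupp.single_le_iff]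
  rcases hu' with hu' | hu'
  · apply hu'
    apply apply_eq_zero_of_eval_mem_aperyAt
    rw [hu, ← eval_single]
    exact eval_mem_aperyAt_of_le hle hA
  · exact rank_maximal_of_le hle h u (by simp [hu]) hu'

lemma apery_subset_box_gamma (S : NumericalSemigroup) : S.apery ⊆ S.box S.gamma := by
  intro w hw
  obtain ⟨a, rfl, ha⟩ := exists_rank_maximal hw.1
  refine ⟨a, rfl, fun g => ⟨fun hg => ?_, fun _ => le_gamma_of_rank_maximal hw ha g⟩⟩
  rw [coe_eq_multiplicity_iff] at hg
  subst hg
  exact apply_eq_zero_of_eval_mem_aperyAt hw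

lemma box_mono {c d : ℕ → ℕ} (h : ∀ g ∈ S.minGens, g ≠ S.multiplicity → c g ≤ d g) :
    S.box c ⊆ S.box d := by
  rintro s ⟨a, ha, hb⟩
  exact ⟨a, ha, fun g => ⟨(hb g).1, fun hg => ((hb g).2 hg).trans (h g g.2 hg)⟩⟩

lemma box_gamma_subset_box_beta (S : NumericalSemigroup) : S.box S.gamma ⊆ S.box S.beta :=
  box_mono fun _ hg _ => gamma_le_beta (pos_of_mem_minGens hg)

lemma box_beta_subset_box_alpha (S : NumericalSemigroup) : S.box S.beta ⊆ S.box S.alpha :=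
  box_mono fun _ hg _ => beta_le_alpha (pos_of_mem_minGens hg)

lemma tau_spec {g : ℕ} (hg : g ∈ S.minGens) (h : g ≠ S.multiplicity) :
    (S.tau g + 1) * g ∈ AddSubmonoid.closure {x | x ∈ S.minGens ∧ x < g} := by
  have hlt : S.multiplicity < g :=
    lt_of_le_of_ne (multiplicity_le (mem_of_mem_minGens hg) hg.2.1) h.symm
  have hm : S.multiplicity ∈ AddSubmonoid.closure {x | x ∈ S.minGens ∧ x < g} :=
    AddSubmonoid.subset_closure ⟨S.multiplicity_mem_minGens, hlt⟩
  -- The set is nonempty because `m g = g m` lies in the monoid generated by `m`, so the infimum is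
  -- attained and subtracting one loses nothing.
  have := Nat.sInf_mem
    (s := {h | 0 < h ∧ h * g ∈ AddSubmonoid.closure {x | x ∈ S.minGens ∧ x < g}})
    ⟨S.multiplicity, S.multiplicity_pos, by rw [mul_comm]; exact nsmul_mem hm g⟩
  rw [tau, Nat.sub_add_cancel this.1]
  exact this.2

lemma eval_lt_degree_mul {a : S.minGens →₀ ℕ} {n : ℕ} (h : ∀ g, a g ≠ 0 → (g : ℕ) < n)
    (h0 : a ≠ 0) : S.eval a < a.degree * n := by
  induction a using Finsupp.induction with
  | zero => exact absurd rfl h0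
  | single_add g k a hga hn ih =>
    have hg : (g : ℕ) < n := h g (by simp; omega)
    have h1 : k * (g : ℕ) < k * n := Nat.mul_lt_mul_of_pos_left hg (Nat.pos_of_ne_zero hn)
    rw [map_add, map_add, eval_single, Finsupp.degree_single, add_mul]
    by_cases ha : a = 0
    · simpa [ha]
    · have := ih (fun g' hg' => h g' (by simp; omega)) ha
      omega

/-- Writing `(τ_g + 1) g` with smaller generators takes more than `τ_g + 1` summands. If `τ_g <
β_g`, this would raise the order of `β_g g` above `β_g`. -/
lemma beta_le_tau {g : ℕ} (hg : g ∈ S.minGens) (h : g ≠ S.multiplicity) :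
    S.beta g ≤ S.tau g := by
  by_contra! hlt
  have hpos := pos_of_mem_minGens hg
  obtain ⟨u, hu, hu'⟩ := (mem_closure_iff_exists_eval (fun x hx => hx.1)).1 (tau_spec hg h)
  have hu0 : u ≠ 0 := by
    rintro rfl
    rw [map_zero] at hu
    have := Nat.mul_pos (Nat.add_one_pos (S.tau g)) hpos
    omega
  have h1 := eval_lt_degree_mul (n := g) (fun j hj => (hu' j hj).2) hu0
  rw [hu] at h1
  have h2 := lt_of_mul_lt_mul_right h1 (Nat.zero_le _)
  have h3 := degree_le_ord (u + Finsupp.single ⟨g, hg⟩ (S.beta g - (S.tau g + 1)))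
  rw [map_add, map_add, eval_single, hu, Finsupp.degree_single, ← add_mul,
    Nat.add_sub_cancel' hlt, (beta_spec hpos).2] at h3
  omega

lemma box_beta_subset_box_tau (S : NumericalSemigroup) : S.box S.beta ⊆ S.box S.tau :=
  box_mono fun _ hg h => beta_le_tau hg h

lemma apery_subset_box_beta (S : NumericalSemigroup) : S.apery ⊆ S.box S.beta :=
  S.apery_subset_box_gamma.trans S.box_gamma_subset_box_beta

lemma apery_subset_box_alpha (S : NumericalSemigroup) : S.apery ⊆ S.box S.alpha :=
  S.apery_subset_box_beta.trans S.box_beta_subset_box_alpha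

lemma apery_subset_box_tau (S : NumericalSemigroup) : S.apery ⊆ S.box S.tau :=
  S.apery_subset_box_beta.trans S.box_beta_subset_box_tau

lemma IsTelescopic.isBetaRectangular (h : S.IsTelescopic) : S.IsBetaRectangular :=
  S.apery_subset_box_beta.antisymm (S.box_beta_subset_box_tau.trans h.ge)

lemma IsAlphaRectangular.isBetaRectangular (h : S.IsAlphaRectangular) : S.IsBetaRectangular :=
  S.apery_subset_box_beta.antisymm (S.box_beta_subset_box_alpha.trans h.ge)

lemma IsBetaRectangular.isGammaRectangular (h : S.IsBetaRectangular) : S.IsGammaRectangular :=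
  S.apery_subset_box_gamma.antisymm (S.box_gamma_subset_box_beta.trans h.ge)

lemma IsPlaneBranch.tau_add_one_mul_lt (h : S.IsPlaneBranch) {p g : ℕ} (hp : p ∈ S.minGens)
    (hg : g ∈ S.minGens) (hm : p ≠ S.multiplicity) (hpg : p < g) : (S.tau p + 1) * p < g := by
  have hmem := Nat.sInf_mem (s := {x | x ∈ S.minGens ∧ p < x}) ⟨g, hg, hpg⟩
  refine lt_of_lt_of_le (h.2 p hp _ hmem.1 hm hmem.2 ?_) (Nat.sInf_le ⟨hg, hpg⟩)
  rintro x hx ⟨h1, h2⟩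
  exact h2.not_ge (Nat.sInf_le ⟨hx, h1⟩)

/-- Let `p` be the largest generator used. By induction the remaining part is less than `p`, so the
total is less than `(τ_p + 1) p`, which is below `g`. -/
lemma IsPlaneBranch.eval_lt (h : S.IsPlaneBranch) {g : S.minGens} {a : S.minGens →₀ ℕ}
    (h0 : a S.fst = 0) (hle : ∀ j, j ≠ S.fst → a j ≤ S.tau j) (hg : ∀ j, g ≤ j → a j = 0) :
    S.eval a < g := by
  induction hn : (g : ℕ) using Nat.strong_induction_on generalizing g a with
  | _ n ih =>
    subst hn
    by_cases ha : a = 0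
    · subst ha; simpa using gen_pos g
    have hne : a.support.Nonempty := Finsupp.support_nonempty_iff.2 ha
    obtain ⟨p, hp, hmax⟩ := a.support.exists_max_image id hne
    rw [Finsupp.mem_support_iff] at hp
    have hpg : p < g := by
      by_contra hc
      exact hp (hg p (not_lt.1 hc))
    have hpf : p ≠ S.fst := fun hc => hp (hc ▸ h0)
    have hlt := ih p hpg (g := p) (a := a.erase p)
      (by rw [Finsupp.erase_ne hpf.symm, h0])
      (fun j hj => by
        by_cases hjp : j = p
        · simp [hjp]
        · rw [Finsupp.erase_ne hjp]; exact hle j hj)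
      (fun j hj => by
        by_cases hjp : j = p
        · simp [hjp]
        · rw [Finsupp.erase_ne hjp]
          by_contra hc
          exact hjp (le_antisymm (hmax j (Finsupp.mem_support_iff.2 hc)) hj)) rfl
    have h1 := h.tau_add_one_mul_lt p.2 g.2 (fun hc => hpf (coe_eq_multiplicity_iff.1 hc)) hpg
    have h2 : S.eval a = a p * p + S.eval (a.erase p) := by
      rw [← eval_single, ← map_add, Finsupp.single_add_erase]
    have h3 := Nat.mul_le_mul_right (p : ℕ) (hle p hpf)
    rw [add_mul, one_mul] at h1
    omega

/-- If `(τ_g + 1) g` were an Apéry element, it would have a representation in the `τ`-box.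
Generators above `g` are too large to occur in it, and those below contribute less than `g`, so the
total falls short. -/
lemma IsPlaneBranch.alpha_le_tau (h : S.IsPlaneBranch) {g : S.minGens} (hg : g ≠ S.fst) :
    S.alpha g ≤ S.tau g := by
  by_contra! hlt
  have hA : (S.tau g + 1) * (g : ℕ) ∈ S.apery := by
    have := eval_mem_aperyAt_of_le (S := S) (a := Finsupp.single g (S.tau g + 1))
      (b := Finsupp.single g (S.alpha g)) (Finsupp.single_mono hlt)
      (by rw [eval_single]; exact alpha_mul_mem_apery (gen_pos g))
    rwa [eval_single] at this
  obtain ⟨a, ha, hbox⟩ := S.apery_subset_box_tau hA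
  have h0 : a S.fst = 0 := (hbox S.fst).1 rfl
  have hle : ∀ j, j ≠ S.fst → a j ≤ S.tau j := fun j hj =>
    (hbox j).2 fun hc => hj (coe_eq_multiplicity_iff.1 hc)
  have h2 : S.eval a = a g * g + S.eval (a.erase g) := by
    rw [← eval_single, ← map_add, Finsupp.single_add_erase]
  have hlt := h.eval_lt (g := g) (a := a.erase g) (by rw [Finsupp.erase_ne hg.symm, h0])
    (fun j hj => by
      by_cases hjp : j = g
      · simp [hjp]
      · rw [Finsupp.erase_ne hjp]; exact hle j hj)
    (fun j hj => by
      by_cases hjp : j = g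
      · simp [hjp]
      · rw [Finsupp.erase_ne hjp]
        have hgj : g < j := lt_of_le_of_ne hj (Ne.symm hjp)
        have hlt := h.tau_add_one_mul_lt g.2 j.2 (fun hc => hg (coe_eq_multiplicity_iff.1 hc)) hgj
        by_contra hc
        have hs : Finsupp.single j 1 ≤ a := by rw [Finsupp.single_le_iff]; omega
        have := eval_mono hs
        rw [ha, eval_single] at this
        omega)
  have h3 := Nat.mul_le_mul_right (g : ℕ) (hle g hg)
  rw [add_mul, one_mul] at ha
  omega

lemma IsPlaneBranch.isAlphaRectangular (h : S.IsPlaneBranch) : S.IsAlphaRectangular := by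
  refine S.apery_subset_box_alpha.antisymm ((box_mono fun g hg hm => ?_).trans h.1.ge)
  exact h.alpha_le_tau (g := ⟨g, hg⟩) fun hc => hm (coe_eq_multiplicity_iff.2 hc)

end NumericalSemigroup

/-! ### Semigroups with a unique Betti element -/

namespace NumericalSemigroup

variable {S : NumericalSemigroup}

section Betti

variable {k : Type*} [Field k]

/-- The homomorphism onto the semigroup ring, `x_g ↦ t^g`. -/
noncomputable def toPoly (S : NumericalSemigroup) (k : Type*) [Field k] :
    MvPolynomial S.minGens k →ₐ[k] Polynomial k :=
  MvPolynomial.aeval (R := k) (fun g : S.minGens => (Polynomial.X : Polynomial k) ^ (g : ℕ))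

lemma mem_definingIdeal {f : MvPolynomial S.minGens k} :
    f ∈ S.definingIdeal k ↔ S.toPoly k f = 0 := RingHom.mem_ker

lemma toPoly_monomial (a : S.minGens →₀ ℕ) (r : k) :
    S.toPoly k (MvPolynomial.monomial a r) = Polynomial.monomial (S.eval a) r := by
  have h : (a.prod fun i n => ((Polynomial.X : Polynomial k) ^ (i : ℕ)) ^ n) =
      Polynomial.X ^ S.eval a := by
    simp only [Finsupp.prod, ← pow_mul, Finset.prod_pow_eq_pow_sum]
    simp [eval, Finsupp.weight_apply, Finsupp.sum, mul_comm]
  rw [toPoly, MvPolynomial.aeval_monomial, h, Polynomial.algebraMap_eq,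
    Polynomial.C_mul_X_pow_eq_monomial]

/-- Gives the homogeneity of the defining ideal: homogeneous components of its elements stay in it.
-/
lemma toPoly_weightedHomogeneousComponent (n : ℕ) (f : MvPolynomial S.minGens k) :
    S.toPoly k (MvPolynomial.weightedHomogeneousComponent (fun g : S.minGens => (g : ℕ)) n f) =
      Polynomial.monomial n ((S.toPoly k f).coeff n) := by
  induction f using MvPolynomial.induction_on' with
  | monomial a r =>
    rw [MvPolynomial.weightedHomogeneousComponent_of_mem
      (n := S.eval a) (MvPolynomial.isWeightedHomogeneous_monomial _ _ _ rfl), toPoly_monomial,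
      Polynomial.coeff_monomial]
    split_ifs with h1 h2 h2
    · rw [toPoly_monomial, h1]
    · exact absurd h1.symm h2
    · exact absurd h2.symm h1
    · simp
  | add p q hp hq => simp only [map_add, hp, hq, Polynomial.coeff_add]

/-- No other monomial contributes to this power of `t`. Hence the monomial of a uniquely represented
value occurs in no element of the defining ideal. -/
lemma coeff_toPoly_of_unique {a : S.minGens →₀ ℕ} (h : ∀ b, S.eval b = S.eval a → b = a)
    (f : MvPolynomial S.minGens k) :
    (S.toPoly k f).coeff (S.eval a) = f.coeff a := by
  induction f using MvPolynomial.induction_on' with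
  | monomial b r =>
    rw [toPoly_monomial, Polynomial.coeff_monomial, MvPolynomial.coeff_monomial]
    by_cases hb : b = a
    · simp [hb]
    · rw [if_neg hb, if_neg fun hc => hb (h b hc)]
  | add p q hp hq => simp only [map_add, hp, hq, Polynomial.coeff_add, MvPolynomial.coeff_add]

lemma coeff_eq_zero_of_mem_mul {a : S.minGens →₀ ℕ}
    (h : ∀ j, a j ≠ 0 → ∀ q ∈ S.definingIdeal k, q.coeff (a - Finsupp.single j 1) = 0)
    {p : MvPolynomial S.minGens k}
    (hp : p ∈ Ideal.span (Set.range (MvPolynomial.X (R := k))) * S.definingIdeal k) :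
    p.coeff a = 0 := by
  refine Submodule.mul_induction_on hp (fun x hx q hq => ?_) fun x y hx hy => ?_
  · induction hx using Submodule.span_induction generalizing q with
    | mem x hx =>
      obtain ⟨j, rfl⟩ := hx
      rw [MvPolynomial.coeff_X_mul']
      split_ifs with hj
      · exact h j (Finsupp.mem_support_iff.1 hj) q hq
      · rfl
    | zero => simp
    | add x y _ _ hx hy => rw [add_mul, MvPolynomial.coeff_add, hx q hq, hy q hq, add_zero]
    | smul r x _ hx =>
      rw [smul_eq_mul, mul_comm r x, mul_assoc]
      exact hx _ (Ideal.mul_mem_left _ r hq)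
  · rw [MvPolynomial.coeff_add, hx, hy, add_zero]

lemma monomial_sub_monomial_mem {a b : S.minGens →₀ ℕ} (h : S.eval a = S.eval b) :
    MvPolynomial.monomial a (1 : k) - MvPolynomial.monomial b 1 ∈ S.definingIdeal k := by
  rw [mem_definingIdeal, map_sub, toPoly_monomial, toPoly_monomial, h, sub_self]

/-- `c g` is the least positive multiple of `g` lying in the monoid generated by the other minimal
generators. -/
def IsCritical (S : NumericalSemigroup) (g : S.minGens) (c : ℕ) : Prop :=
  0 < c ∧ (∃ u, S.eval u = c * g ∧ u g = 0) ∧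
    ∀ h, 0 < h → h < c → ∀ u, S.eval u = h * g → u g ≠ 0

lemma exists_isCritical {g g' : S.minGens} (h : g ≠ g') : ∃ c, S.IsCritical g c := by
  classical
  have hex : ∃ c, 0 < c ∧ ∃ u, S.eval u = c * g ∧ u g = 0 :=
    ⟨g', gen_pos g', Finsupp.single g' g, by simp [mul_comm], by
      rw [Finsupp.single_apply, if_neg h.symm]⟩
  refine ⟨Nat.find hex, (Nat.find_spec hex).1, (Nat.find_spec hex).2, fun h h0 hlt u hu hug => ?_⟩
  exact Nat.find_min hex hlt ⟨h0, u, hu, hug⟩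

/-- Below the critical multiple every representation of `h g` must use `g`. Removing one copy gives
the induction. -/
lemma IsCritical.eq_single {g : S.minGens} {c h : ℕ} (hc : S.IsCritical g c) (hh : h < c)
    {u : S.minGens →₀ ℕ} (hu : S.eval u = h * g) : u = Finsupp.single g h := by
  induction h generalizing u with
  | zero => rw [Finsupp.single_zero]; exact eval_eq_zero_iff.1 (by simpa using hu)
  | succ h ih =>
    have h0 := hc.2.2 (h + 1) (by omega) hh u hu
    have hle : Finsupp.single g 1 ≤ u := by rw [Finsupp.single_le_iff]; omega
    obtain ⟨v, rfl⟩ := exists_add_of_le hle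
    rw [map_add, eval_single, add_mul, add_comm] at hu
    rw [ih (by omega) (Nat.add_right_cancel hu), ← Finsupp.single_add, add_comm]

/-- The binomial `x_g ^ c - x ^ u` is not in `𝔪 I`: otherwise `x_g ^ (c - 1)` would occur in some
element of `I`, although its value is uniquely represented. -/
lemma IsCritical.mem_firstSyzygyDegrees {g : S.minGens} {c : ℕ} (hc : S.IsCritical g c) :
    c * g ∈ S.firstSyzygyDegrees k := by
  obtain ⟨u, hu, hug⟩ := hc.2.1
  have hne : u ≠ Finsupp.single g c := by
    rintro rfl
    rw [Finsupp.single_eq_same] at hug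
    exact hc.1.ne' hug
  refine ⟨MvPolynomial.monomial (Finsupp.single g c) 1 - MvPolynomial.monomial u 1,
    monomial_sub_monomial_mem (by rw [eval_single, hu]), ?_, fun hmem => ?_⟩
  · exact (MvPolynomial.isWeightedHomogeneous_monomial _ _ _ (eval_single g c)).sub
      (MvPolynomial.isWeightedHomogeneous_monomial _ _ _ hu)
  · have := coeff_eq_zero_of_mem_mul (a := Finsupp.single g c) (fun j hj q hq => ?_) hmem
    · simp [MvPolynomial.coeff_monomial, hne] at this
    · rw [Finsupp.single_apply_ne_zero] at hj
      have hlt : c - 1 < c := Nat.sub_lt hc.1 one_pos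
      rw [hj.1, ← Finsupp.single_tsub, ← coeff_toPoly_of_unique, mem_definingIdeal.1 hq,
        Polynomial.coeff_zero]
      intro b hb
      rw [eval_single] at hb
      exact hc.eq_single hlt hb

lemma HasUniqueBettiElement.critical_eq (h : S.HasUniqueBettiElement k) {g g' : S.minGens}
    {c c' : ℕ} (hc : S.IsCritical g c) (hc' : S.IsCritical g' c') : c * (g : ℕ) = c' * g' :=
  h hc.mem_firstSyzygyDegrees hc'.mem_firstSyzygyDegrees

/-- Consider the component of degree `eval a`. If it lies in `𝔪 I`, the claim descends to the
vectors `a - e_j`. Otherwise `eval a` is the Betti degree `c_j j`. For `j` in the support of `a`,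
cancelling `a_j j` then expresses a smaller positive multiple of `j` by the other generators. -/
lemma HasUniqueBettiElement.coeff_eq_zero (h : S.HasUniqueBettiElement k) {c : S.minGens → ℕ}
    (hc : ∀ g, S.IsCritical g (c g)) {a : S.minGens →₀ ℕ} (ha : ∀ g, a g < c g)
    {f : MvPolynomial S.minGens k} (hf : f ∈ S.definingIdeal k) : f.coeff a = 0 := by
  induction hn : S.eval a using Nat.strong_induction_on generalizing a f with
  | _ n ih =>
    subst hn
    set f' := MvPolynomial.weightedHomogeneousComponent (fun g : S.minGens => (g : ℕ))
      (S.eval a) f with hf'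
    have hcoeff : f'.coeff a = f.coeff a := by
      rw [hf', MvPolynomial.coeff_weightedHomogeneousComponent, if_pos]; rfl
    have hmem : f' ∈ S.definingIdeal k := by
      rw [mem_definingIdeal, hf', toPoly_weightedHomogeneousComponent, mem_definingIdeal.1 hf]
      simp
    rw [← hcoeff]
    by_cases hm : f' ∈ Ideal.span (Set.range (MvPolynomial.X (R := k))) * S.definingIdeal k
    · refine coeff_eq_zero_of_mem_mul (fun j hj q hq => ?_) hm
      have hle : Finsupp.single j 1 ≤ a := by rw [Finsupp.single_le_iff]; omega
      refine ih (S.eval (a - Finsupp.single j 1)) ?_ (fun g => ?_) hq rfl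
      · have h1 := eval_mono hle
        have := gen_pos j
        rw [eval_single] at h1
        omega
      · exact lt_of_le_of_lt (Nat.sub_le _ _) (ha g)
    · have hdeg : S.eval a ∈ S.firstSyzygyDegrees k :=
        ⟨f', hmem, MvPolynomial.weightedHomogeneousComponent_isWeightedHomogeneous _ _, hm⟩
      by_cases ha0 : a = 0
      · have h1 : S.eval a = c S.fst * (S.fst : ℕ) := h hdeg (hc _).mem_firstSyzygyDegrees
        rw [ha0, map_zero] at h1
        have := Nat.mul_pos (hc S.fst).1 (gen_pos S.fst)
        omega
      · obtain ⟨j, hj⟩ := Finsupp.ne_iff.1 ha0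
        rw [Finsupp.zero_apply] at hj
        have h1 : S.eval a = c j * (j : ℕ) := h hdeg (hc j).mem_firstSyzygyDegrees
        have h2 : S.eval a = a j * j + S.eval (a.erase j) := by
          rw [← eval_single, ← map_add, Finsupp.single_add_erase]
        have hlt := ha j
        refine absurd Finsupp.erase_same ((hc j).2.2 (c j - a j) (by omega) (by omega)
          (a.erase j) ?_)
        rw [Nat.sub_mul]
        omega

lemma HasUniqueBettiElement.eq_of_eval_eq (h : S.HasUniqueBettiElement k) {c : S.minGens → ℕ}
    (hc : ∀ g, S.IsCritical g (c g)) {a b : S.minGens →₀ ℕ} (ha : ∀ g, a g < c g)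
    (hab : S.eval b = S.eval a) : b = a := by
  by_contra hne
  have := h.coeff_eq_zero hc ha (monomial_sub_monomial_mem (k := k) hab.symm)
  simp [MvPolynomial.coeff_monomial, hne] at this

/-- A box vector below the critical multiples is the only representation of its value and does not
use `g₁`, so the value is an Apéry element. With a single generator there are no critical multiples,
but the box is then `{0}`. -/
lemma HasUniqueBettiElement.box_subset_apery (h : S.HasUniqueBettiElement k) {d : ℕ → ℕ}
    (hd : ∀ g : S.minGens, g ≠ S.fst → ∀ c₁ c, S.IsCritical S.fst c₁ → S.IsCritical g c →
      d g < c) : S.box d ⊆ S.apery := by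
  rintro s ⟨a, rfl, ha⟩
  have h0 : a S.fst = 0 := (ha S.fst).1 rfl
  by_cases hex : ∃ g : S.minGens, g ≠ S.fst
  · obtain ⟨g₀, hg₀⟩ := hex
    have : ∀ g : S.minGens, ∃ c, S.IsCritical g c := fun g => by
      by_cases hg : g = S.fst
      · exact exists_isCritical (hg ▸ hg₀.symm)
      · exact exists_isCritical hg
    choose c hc using this
    by_contra hA
    obtain ⟨b, hb, hb0⟩ := exists_eval_of_notMem_aperyAt (g := S.fst) (eval_mem a) hA
    rw [h.eq_of_eval_eq hc (a := a) (fun g => ?_) hb] at hb0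
    · exact hb0 h0
    · by_cases hg : g = S.fst
      · rw [hg, h0]; exact (hc _).1
      · exact ((ha g).2 fun e => hg (coe_eq_multiplicity_iff.1 e)).trans_lt
          (hd g hg _ _ (hc _) (hc g))
  · push Not at hex
    have : a = 0 := by
      ext g
      rw [hex g, h0, Finsupp.zero_apply]
    rw [this, map_zero]
    exact S.zero_mem_apery

lemma HasUniqueBettiElement.isAlphaRectangular (h : S.HasUniqueBettiElement k) :
    S.IsAlphaRectangular := by
  refine S.apery_subset_box_alpha.antisymm (h.box_subset_apery fun g _ c₁ c hc₁ hc => ?_)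
  by_contra! hle
  have hA := eval_mem_aperyAt_of_le (S := S) (n := S.multiplicity)
    (Finsupp.single_mono hle : Finsupp.single g c ≤ Finsupp.single g (S.alpha g))
    (by rw [eval_single]; exact alpha_mul_mem_apery (gen_pos g))
  -- All critical degrees agree, so `c g = c₁ g₁`, a positive multiple of `g₁`, which cannot be an
  -- Apéry element.
  rw [eval_single, h.critical_eq hc hc₁, ← eval_single] at hA
  have := apply_eq_zero_of_eval_mem_aperyAt (g := S.fst) hA
  rw [Finsupp.single_eq_same] at this
  exact hc₁.1.ne' this

lemma HasUniqueBettiElement.isTelescopic (h : S.HasUniqueBettiElement k) : S.IsTelescopic := by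
  refine S.apery_subset_box_tau.antisymm (h.box_subset_apery fun g hg c₁ c hc₁ hc => ?_)
  have hlt : S.multiplicity < g :=
    lt_of_le_of_ne (multiplicity_le (mem_of_mem_minGens g.2) (gen_pos g).ne')
      fun e => hg (coe_eq_multiplicity_iff.1 e.symm)
  have hm : S.multiplicity ∈ AddSubmonoid.closure {x | x ∈ S.minGens ∧ x < g} :=
    AddSubmonoid.subset_closure ⟨S.multiplicity_mem_minGens, hlt⟩
  have : sInf {h | 0 < h ∧ h * (g : ℕ) ∈ AddSubmonoid.closure {x | x ∈ S.minGens ∧ x < g}} ≤ c :=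
    Nat.sInf_le ⟨hc.1, by rw [h.critical_eq hc hc₁]; exact nsmul_mem hm c₁⟩
  have h1 := hc.1
  unfold tau
  omega

end Betti

end NumericalSemigroup

/-! ### Cycles and enumerations in finite types -/

/-- A self-map of a finite set permutes a nonempty subset. -/
lemma Finset.exists_subset_image_eq {ι : Type*} [DecidableEq ι] (f : ι → ι) (C : Finset ι)
    (hC : C.Nonempty) (hf : ∀ g ∈ C, f g ∈ C) : ∃ P ⊆ C, P.Nonempty ∧ P.image f = P := by
  induction C using Finset.strongInduction with
  | H C ih =>
    -- Taking images gives a decreasing chain of nonempty finite sets, which must stabilise.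
    have hsub : C.image f ⊆ C := Finset.image_subset_iff.2 hf
    rcases hsub.eq_or_ssubset with h | h
    · exact ⟨C, subset_rfl, hC, h⟩
    · obtain ⟨P, hP, h1, h2⟩ := ih _ h (hC.image f) fun g hg =>
        Finset.mem_image_of_mem f (hsub hg)
      exact ⟨P, hP.trans hsub, h1, h2⟩

/-- A relation on a finite type that is acyclic away from `x₀` can be enumerated so that the
relatives of each element precede it. -/
lemma exists_enumeration {ι : Type*} [Fintype ι] (R : ι → ι → Prop) (x₀ : ι)
    (hR : ∀ C : Finset ι, C.Nonempty → x₀ ∉ C → ∃ g ∈ C, ∀ j ∈ C, ¬ R g j) :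
    ∃ e : ℕ → ι, Set.BijOn e (Set.Icc 1 (Fintype.card ι)) Set.univ ∧ e 1 = x₀ ∧
      ∀ i ∈ Set.Icc 2 (Fintype.card ι), ∀ j, R (e i) j → j ∈ e '' Set.Ico 1 i := by
  classical
  have key : ∀ k, 1 ≤ k → k ≤ Fintype.card ι → ∃ e : ℕ → ι, Set.InjOn e (Set.Icc 1 k) ∧
      e 1 = x₀ ∧ ∀ i ∈ Set.Icc 2 k, ∀ j, R (e i) j → j ∈ e '' Set.Ico 1 i := by
    intro k hk
    induction k, hk using Nat.le_induction with
    | base =>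
      refine fun _ => ⟨fun _ => x₀, ?_, rfl, ?_⟩
      · rw [Set.Icc_self]; exact Set.injOn_singleton _ _
      · rintro i ⟨h1, h2⟩; omega
    | succ k hk ih =>
      intro hle
      obtain ⟨e, hinj, h1, hprec⟩ := ih (by omega)
      set U := (Finset.Icc 1 k).image e with hU
      have hcard : U.card < Fintype.card ι :=
        lt_of_le_of_lt Finset.card_image_le (by rw [Nat.card_Icc]; omega)
      have hne : Uᶜ.Nonempty := by
        rw [← Finset.card_pos, Finset.card_compl]; omega
      -- The next element is one without relatives among those not yet listed, so all its relatives
      -- precede it.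
      obtain ⟨g, hg, hgR⟩ := hR Uᶜ hne (by
        rw [Finset.mem_compl, not_not, hU, ← h1]
        exact Finset.mem_image_of_mem e (Finset.mem_Icc.2 ⟨le_rfl, hk⟩))
      have hgU : ∀ i ∈ Set.Icc 1 k, e i ≠ g := by
        rintro i hi rfl
        exact Finset.mem_compl.1 hg (Finset.mem_image_of_mem e (Finset.mem_Icc.2 hi))
      have hupd : ∀ i, i ≤ k → Function.update e (k + 1) g i = e i := fun i hi =>
        Function.update_of_ne (by omega) _ _
      refine ⟨Function.update e (k + 1) g, ?_, ?_, ?_⟩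
      · rintro i ⟨hi1, hi2⟩ j ⟨hj1, hj2⟩ hij
        rcases Nat.lt_or_ge k i with hi | hi <;> rcases Nat.lt_or_ge k j with hj | hj
        · omega
        · obtain rfl : i = k + 1 := by omega
          rw [Function.update_self, hupd j hj] at hij
          exact absurd hij.symm (hgU j ⟨hj1, hj⟩)
        · obtain rfl : j = k + 1 := by omega
          rw [Function.update_self, hupd i hi] at hij
          exact absurd hij (hgU i ⟨hi1, hi⟩)
        · rw [hupd i hi, hupd j hj] at hij
          exact hinj ⟨hi1, hi⟩ ⟨hj1, hj⟩ hij
      · rw [hupd 1 hk, h1]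
      · rintro i ⟨hi1, hi2⟩ j hj
        have himg : Function.update e (k + 1) g '' Set.Ico 1 i = e '' Set.Ico 1 i :=
          Set.image_congr fun l hl => hupd l (by have := hl.2; omega)
        rw [himg]
        rcases Nat.lt_or_ge k i with hi | hi
        · obtain rfl : i = k + 1 := by omega
          rw [Function.update_self] at hj
          by_contra hc
          refine hgR j (Finset.mem_compl.2 fun hm => hc ?_) hj
          obtain ⟨l, hl, rfl⟩ := Finset.mem_image.1 hm
          rw [Finset.mem_Icc] at hl
          exact ⟨l, ⟨hl.1, by omega⟩, rfl⟩
        · rw [hupd i hi] at hj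
          exact hprec i ⟨hi1, hi⟩ j hj
  obtain ⟨e, hinj, h1, h2⟩ := key _ (Fintype.card_pos_iff.2 ⟨x₀⟩) le_rfl
  refine ⟨e, ⟨Set.mapsTo_univ _ _, hinj, fun g _ => ?_⟩, h1, h2⟩
  have : (Finset.Icc 1 (Fintype.card ι)).image e = Finset.univ := by
    rw [← Finset.card_eq_iff_eq_univ, Finset.card_image_of_injOn (by simpa using hinj),
      Nat.card_Icc, Nat.add_sub_cancel]
  obtain ⟨i, hi, rfl⟩ := Finset.mem_image.1 (this ▸ Finset.mem_univ g)
  exact ⟨i, Finset.mem_Icc.1 hi, rfl⟩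

/-! ### From a `γ`-rectangular Apéry set to freeness -/

namespace NumericalSemigroup

variable {S : NumericalSemigroup}

lemma eval_injOn_le {a b : S.minGens →₀ ℕ} (h : a ≤ b) (he : S.eval a = S.eval b) : a = b := by
  have h1 := eval_mono h
  have h2 : b - a = 0 := eval_eq_zero_iff.1 (by omega)
  exact le_antisymm h (tsub_eq_zero_iff_le.1 h2)

lemma phi_spec {n : ℕ → ℕ} {i : ℕ} (h1 : 0 < n 1) (hi : 2 ≤ i) :
    (phi n i + 1) * n i ∈ AddSubmonoid.closure (n '' Set.Ico 1 i) := by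
  have hm : n 1 ∈ AddSubmonoid.closure (n '' Set.Ico 1 i) :=
    AddSubmonoid.subset_closure ⟨1, ⟨le_rfl, by omega⟩, rfl⟩
  have := Nat.sInf_mem (s := {h | 0 < h ∧ h * n i ∈ AddSubmonoid.closure (n '' Set.Ico 1 i)})
    ⟨n 1, h1, by rw [mul_comm]; exact nsmul_mem hm (n i)⟩
  rw [phi, Nat.sub_add_cancel this.1]
  exact this.2

lemma phi_le {n : ℕ → ℕ} {i h : ℕ} (hh : (h + 1) * n i ∈ AddSubmonoid.closure (n '' Set.Ico 1 i)) :
    phi n i ≤ h := by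
  have : sInf {h | 0 < h ∧ h * n i ∈ AddSubmonoid.closure (n '' Set.Ico 1 i)} ≤ h + 1 :=
    Nat.sInf_le ⟨Nat.succ_pos h, hh⟩
  unfold phi
  omega

/-- Divide the coefficient of the last generator by `φ + 1`: the remainder is kept, and the quotient
many blocks `(φ + 1) n_i` are absorbed by the earlier generators. The coefficient of `n 1` remains
unbounded. -/
lemma exists_phi_bounded {n : ℕ → ℕ} (h1 : 0 < n 1) {k : ℕ} (hk : 1 ≤ k) {y : ℕ}
    (hy : y ∈ AddSubmonoid.closure (n '' Set.Icc 1 k)) :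
    ∃ (c : ℕ) (l : ℕ → ℕ), (∀ i ∈ Finset.Icc 2 k, l i ≤ phi n i) ∧
      y = c * n 1 + ∑ i ∈ Finset.Icc 2 k, l i * n i := by
  induction k, hk using Nat.le_induction generalizing y with
  | base =>
    rw [Set.Icc_self, Set.image_singleton, AddSubmonoid.mem_closure_singleton] at hy
    obtain ⟨c, rfl⟩ := hy
    exact ⟨c, fun _ => 0, by simp, by simp⟩
  | succ k hk ih =>
    have hIcc : Set.Icc 1 (k + 1) = insert (k + 1) (Set.Icc 1 k) := by
      ext i; simp only [Set.mem_Icc, Set.mem_insert_iff]; omega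
    have hIco : Set.Ico 1 (k + 1) = Set.Icc 1 k := by
      ext i; simp only [Set.mem_Icc, Set.mem_Ico]; omega
    rw [hIcc, Set.image_insert_eq, Set.insert_eq, AddSubmonoid.closure_union,
      AddSubmonoid.mem_sup] at hy
    obtain ⟨x, hx, y, hy, rfl⟩ := hy
    rw [AddSubmonoid.mem_closure_singleton] at hx
    obtain ⟨t, rfl⟩ := hx
    have hphi := phi_spec (n := n) (i := k + 1) h1 (by omega)
    rw [hIco] at hphi
    obtain ⟨c, l, hl, hsum⟩ := ih (add_mem hy (nsmul_mem hphi (t / (phi n (k + 1) + 1))))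
    refine ⟨c, Function.update l (k + 1) (t % (phi n (k + 1) + 1)), fun i hi => ?_, ?_⟩
    · rw [Finset.mem_Icc] at hi
      by_cases hik : i = k + 1
      · subst hik
        rw [Function.update_self]
        exact Nat.lt_succ_iff.1 (Nat.mod_lt _ (Nat.succ_pos _))
      · rw [Function.update_of_ne hik]
        exact hl i (Finset.mem_Icc.2 ⟨hi.1, by omega⟩)
    · rw [Finset.sum_Icc_succ_top (by omega), Function.update_self,
        Finset.sum_congr rfl (g := fun i => l i * n i), ← add_assoc, ← hsum]
      · conv_lhs => rw [← Nat.div_add_mod t (phi n (k + 1) + 1)]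
        simp only [smul_eq_mul]
        ring
      · intro i hi
        rw [Finset.mem_Icc] at hi
        rw [Function.update_of_ne (by omega)]

lemma mem_closure_minGens {s : ℕ} : s ∈ AddSubmonoid.closure S.minGens ↔ s ∈ S := by
  rw [mem_closure_iff_exists_eval subset_rfl]
  exact ⟨fun ⟨a, ha, _⟩ => ha ▸ eval_mem a,
    fun hs => (exists_eval_eq hs).imp fun a ha => ⟨ha, fun g _ => g.2⟩⟩

lemma embDim_pos (S : NumericalSemigroup) : 1 ≤ S.embDim :=
  (Set.ncard_pos S.minGens_finite).2 ⟨_, S.multiplicity_mem_minGens⟩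

lemma aperyAt_subset_phi_box {n : ℕ → ℕ} (hn : Set.BijOn n (Set.Icc 1 S.embDim) S.minGens) :
    S.aperyAt (n 1) ⊆ {s | ∃ l : ℕ → ℕ, (∀ i ∈ Finset.Icc 2 S.embDim, l i ≤ phi n i) ∧
        s = ∑ i ∈ Finset.Icc 2 S.embDim, l i * n i} := by
  intro s hs
  have h1 : n 1 ∈ S.minGens := hn.mapsTo ⟨le_rfl, S.embDim_pos⟩
  have hmem := mem_closure_minGens.2 hs.1
  rw [← hn.image_eq] at hmem
  obtain ⟨c, l, hl, rfl⟩ := exists_phi_bounded (pos_of_mem_minGens h1) S.embDim_pos hmem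
  refine ⟨l, hl, ?_⟩
  cases c with
  | zero => simp
  | succ c =>
    refine absurd ⟨c * n 1 + ∑ i ∈ Finset.Icc 2 S.embDim, l i * n i, ?_, by ring⟩ hs.2
    refine add_mem (nsmul_mem h1.1 c) (sum_mem fun i hi => nsmul_mem (?_ : n i ∈ S) (l i))
    rw [Finset.mem_Icc] at hi
    exact mem_of_mem_minGens (hn.mapsTo ⟨by omega, hi.2⟩)

lemma rank_sum_lt_rank_sum {ι : Type*} {P : Finset ι} (hP : P.Nonempty)
    {x y : ι → S.minGens →₀ ℕ} (h : ∀ i ∈ P, rank (x i) < rank (y i)) :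
    rank (∑ i ∈ P, x i) < rank (∑ i ∈ P, y i) := by
  induction hP using Finset.Nonempty.cons_induction with
  | singleton i => simpa using h i (by simp)
  | cons i P hi hP ih =>
    have h1 := ih fun j hj => h j (Finset.mem_cons_of_mem hj)
    have h2 := h i (Finset.mem_cons_self i P)
    rw [Finset.sum_cons, Finset.sum_cons]
    rw [rank_lt_rank_iff] at *
    simp only [map_add]
    omega

open Classical in
/-- The largest exponent vector of the `γ`-box. -/
noncomputable def gammaTop (S : NumericalSemigroup) : S.minGens →₀ ℕ :=
  Finsupp.equivFunOnFinite.symm fun g => if g = S.fst then 0 else S.gamma g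

lemma gammaTop_fst : S.gammaTop S.fst = 0 := by simp [gammaTop]

lemma gammaTop_of_ne {g : S.minGens} (hg : g ≠ S.fst) : S.gammaTop g = S.gamma g := by
  simp [gammaTop, hg]

lemma eval_gammaTop_mem_box : S.eval S.gammaTop ∈ S.box S.gamma :=
  ⟨_, rfl, fun g => ⟨fun hg => by rw [coe_eq_multiplicity_iff.1 hg, gammaTop_fst],
    fun hg => (gammaTop_of_ne fun hc => hg (coe_eq_multiplicity_iff.2 hc)).le⟩⟩

lemma IsGammaRectangular.eval_mem_apery (h : S.IsGammaRectangular) {a : S.minGens →₀ ℕ}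
    (ha : a ≤ S.gammaTop) : S.eval a ∈ S.apery :=
  eval_mem_aperyAt_of_le ha (h.ge eval_gammaTop_mem_box)

/-- It suffices to treat the top vector. A rank-maximal representation of its value is bounded by it
coordinatewise, and two comparable vectors with equal values coincide. -/
lemma IsGammaRectangular.rank_maximal (h : S.IsGammaRectangular) {a : S.minGens →₀ ℕ}
    (ha : a ≤ S.gammaTop) : ∀ c, S.eval c = S.eval a → ¬ rank a < rank c := by
  refine rank_maximal_of_le ha ?_
  obtain ⟨b, hb, hmax⟩ := exists_rank_maximal (eval_mem S.gammaTop)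
  have hA : S.eval b ∈ S.apery := hb ▸ h.eval_mem_apery le_rfl
  have hle : b ≤ S.gammaTop := fun g => by
    by_cases hg : g = S.fst
    · rw [hg, apply_eq_zero_of_eval_mem_aperyAt (g := S.fst) hA]; exact Nat.zero_le _
    · rw [gammaTop_of_ne hg]
      exact le_gamma_of_rank_maximal hA (by rwa [hb]) g
  obtain rfl := eval_injOn_le hle hb
  exact hmax

/-- Rewriting each `(γ_g + 1) g` as a better representation is acyclic. -/
lemma IsGammaRectangular.exists_mem_forall_eq_zero (h : S.IsGammaRectangular)
    {u : S.minGens → S.minGens →₀ ℕ} (hu : ∀ g, S.eval (u g) = (S.gamma g + 1) * g ∧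
      (u g S.fst ≠ 0 ∨ rank (Finsupp.single g (S.gamma g + 1)) < rank (u g)))
    (C : Finset S.minGens) (hC : C.Nonempty) (h0 : S.fst ∉ C) :
    ∃ g ∈ C, ∀ j ∈ C, ¬ u g j ≠ 0 := by
  classical
  by_contra! hc
  have : ∀ g, ∃ j, g ∈ C → j ∈ C ∧ u g j ≠ 0 := fun g => by
    by_cases hg : g ∈ C
    · obtain ⟨j, hj⟩ := hc g hg
      exact ⟨j, fun _ => hj⟩
    · exact ⟨g, fun h => absurd h hg⟩
  choose f hf using this
  obtain ⟨P, hPC, hP, himg⟩ := Finset.exists_subset_image_eq f C hC fun g hg => (hf g hg).1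
  -- Sum the rewritings over the cycle `P`. The left sides add up to `A + E`. The right sides
  -- contain `E`, because `f` permutes `P` and `u g` uses `f g`. Cancelling `E` leaves a vector `B`
  -- with the value of `A`.
  set A : S.minGens →₀ ℕ := ∑ g ∈ P, Finsupp.single g (S.gamma g) with hA
  set E : S.minGens →₀ ℕ := ∑ g ∈ P, Finsupp.single g 1 with hE
  have hEle : E ≤ ∑ g ∈ P, u g := by
    have : E = ∑ g ∈ P, Finsupp.single (f g) 1 := by
      have hinj : Set.InjOn f P := Finset.injOn_of_card_image_eq (by rw [himg])
      rw [hE, ← Finset.sum_image (f := fun g => (Finsupp.single g 1 : S.minGens →₀ ℕ)) hinj, himg]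
    rw [this]
    refine Finset.sum_le_sum fun g hg => ?_
    rw [Finsupp.single_le_iff]
    exact Nat.one_le_iff_ne_zero.2 (hf g (hPC hg)).2
  obtain ⟨B, hB⟩ := exists_add_of_le hEle
  have hAE : A + E = ∑ g ∈ P, Finsupp.single g (S.gamma g + 1) := by
    rw [hA, hE, ← Finset.sum_add_distrib]
    exact Finset.sum_congr rfl fun g _ => (Finsupp.single_add _ _ _).symm
  have hev : S.eval B = S.eval A := by
    have : S.eval (A + E) = S.eval (∑ g ∈ P, u g) := by
      rw [hAE, map_sum, map_sum]
      exact Finset.sum_congr rfl fun g _ => by rw [eval_single, (hu g).1]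
    rw [hB, map_add, map_add] at this
    omega
  have hAle : A ≤ S.gammaTop := fun j => by
    rw [hA, Finsupp.finsetSum_apply]
    simp only [Finsupp.single_apply, Finset.sum_ite_eq']
    split_ifs with hj
    · rw [gammaTop_of_ne fun hjf => h0 (hjf ▸ hPC hj)]
    · exact Nat.zero_le _
  have hBA : S.eval B ∈ S.apery := hev ▸ h.eval_mem_apery hAle
  -- `B` represents an Apéry element, so no rewriting on the cycle uses `g₁`. All of them must then
  -- increase the rank, and so `B` outranks `A`.
  have hsum0 : (∑ g ∈ P, u g) S.fst = 0 := by
    rw [hB, Finsupp.add_apply, apply_eq_zero_of_eval_mem_aperyAt (g := S.fst) hBA, hE,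
      Finsupp.finsetSum_apply, add_zero]
    exact Finset.sum_eq_zero fun g hg => by
      rw [Finsupp.single_apply]
      exact if_neg fun hgf : g = S.fst => h0 (hgf ▸ hPC hg)
  rw [Finsupp.finsetSum_apply, Finset.sum_eq_zero_iff] at hsum0
  have hlt := rank_sum_lt_rank_sum hP fun g hg => ((hu g).2.resolve_left (not_not.2 (hsum0 g hg)))
  rw [← hAE, hB, add_comm E B, rank_add_lt_rank_add_iff] at hlt
  exact h.rank_maximal hAle B hev hlt

/-- In an order adapted to the acyclic rewritings, `(γ_g + 1) g` lies in the monoid of the earlier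
generators. Hence `φ ≤ γ`, and the `φ`-box lies below `gammaTop`. -/
lemma IsGammaRectangular.isFree (h : S.IsGammaRectangular) : S.IsFree := by
  classical
  have := Fintype.ofFinite S.minGens
  have hcard : Fintype.card S.minGens = S.embDim := by
    rw [embDim, ← Nat.card_coe_set_eq, Nat.card_eq_fintype_card]
  choose u hu using fun g : S.minGens => exists_better_rep (S := S) (Nat.lt_succ_self (S.gamma g))
  obtain ⟨e, hbij, he1, hprec⟩ := exists_enumeration (fun g j => u g j ≠ 0) S.fst
    (h.exists_mem_forall_eq_zero hu)
  rw [hcard] at hbij hprec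
  have hn : Set.BijOn (fun i => (e i : ℕ)) (Set.Icc 1 S.embDim) S.minGens :=
    ⟨fun i _ => (e i).2, fun i hi j hj hij => hbij.injOn hi hj (Subtype.ext hij), fun g hg => by
      obtain ⟨i, hi, hie⟩ := hbij.surjOn (Set.mem_univ ⟨g, hg⟩)
      exact ⟨i, hi, congrArg Subtype.val hie⟩⟩
  refine ⟨fun i => (e i : ℕ), hn, (aperyAt_subset_phi_box hn).antisymm ?_⟩
  rintro s ⟨l, hl, rfl⟩
  have hne : ∀ i ∈ Finset.Icc 2 S.embDim, e i ≠ S.fst := fun i hi hc => by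
    rw [Finset.mem_Icc] at hi
    have := hbij.injOn (⟨by omega, hi.2⟩ : i ∈ Set.Icc 1 S.embDim) ⟨le_rfl, S.embDim_pos⟩
      (hc.trans he1.symm)
    omega
  have hphi : ∀ i ∈ Finset.Icc 2 S.embDim, phi (fun i => (e i : ℕ)) i ≤ S.gamma (e i) := by
    intro i hi
    rw [Finset.mem_Icc] at hi
    refine phi_le ((mem_closure_iff_exists_eval ?_).2 ⟨u (e i), (hu (e i)).1, fun j hj => ?_⟩)
    · rintro _ ⟨j, -, rfl⟩
      exact (e j).2
    · obtain ⟨t, ht, rfl⟩ := hprec i hi j hj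
      exact ⟨t, ht, rfl⟩
  have hsum : ∑ i ∈ Finset.Icc 2 S.embDim, l i * (e i : ℕ) =
      S.eval (∑ i ∈ Finset.Icc 2 S.embDim, Finsupp.single (e i) (l i)) := by
    simp [map_sum]
  rw [hsum, he1]
  refine h.eval_mem_apery ?_
  calc ∑ i ∈ Finset.Icc 2 S.embDim, Finsupp.single (e i) (l i)
      ≤ ∑ i ∈ Finset.Icc 2 S.embDim, Finsupp.single (e i) (S.gammaTop (e i)) :=
        Finset.sum_le_sum fun i hi => Finsupp.single_mono
          (((hl i hi).trans (hphi i hi)).trans (gammaTop_of_ne (hne i hi)).ge)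
    _ = ∑ g ∈ (Finset.Icc 2 S.embDim).image e, Finsupp.single g (S.gammaTop g) := by
        rw [Finset.sum_image fun i hi j hj hij => ?_]
        simp only [Finset.coe_Icc, Set.mem_Icc] at hi hj
        exact hbij.injOn ⟨by omega, hi.2⟩ ⟨by omega, hj.2⟩ hij
    _ ≤ S.gammaTop := fun j => by
        rw [Finsupp.finsetSum_apply]
        simp only [Finsupp.single_apply, Finset.sum_ite_eq']
        split_ifs <;> simp

end NumericalSemigroup

/-! ### Cardinality of presentations -/

namespace NumericalSemigroup

variable {S : NumericalSemigroup}

lemma toENat_rank_span_le_encard {V : Type*} [AddCommGroup V] [Module ℚ V] (s : Set V) :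
    (Module.rank ℚ (Submodule.span ℚ s)).toENat ≤ s.encard :=
  Cardinal.toENat.monotone' (rank_span_le s)

/-- The kernel congruence as a set of pairs. -/
def kerPairs (S : NumericalSemigroup) : Set ((S.minGens →₀ ℕ) × (S.minGens →₀ ℕ)) :=
  {p | S.eval p.1 = S.eval p.2}

lemma addConGen_le_ker {ρ : Set ((S.minGens →₀ ℕ) × (S.minGens →₀ ℕ))} (h : ρ ⊆ S.kerPairs) :
    addConGen (fun a b => (a, b) ∈ ρ) ≤ AddCon.ker S.eval :=
  AddCon.addConGen_le.2 fun _ _ hab => (AddCon.ker_rel _).2 (h hab)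

lemma IsPresentation.subset_kerPairs {ρ : Set ((S.minGens →₀ ℕ) × (S.minGens →₀ ℕ))}
    (h : S.IsPresentation ρ) : ρ ⊆ S.kerPairs := fun p hp => by
  have : addConGen (fun a b => (a, b) ∈ ρ) p.1 p.2 := AddConGen.Rel.of _ _ hp
  rw [h] at this
  exact (AddCon.ker_rel _).1 this

lemma IsPresentation.addConGen_of_eval_eq {ρ : Set ((S.minGens →₀ ℕ) × (S.minGens →₀ ℕ))}
    (h : S.IsPresentation ρ) {a b : S.minGens →₀ ℕ} (hab : S.eval a = S.eval b) :
    addConGen (fun a b => (a, b) ∈ ρ) a b := by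
  rw [h]; exact (AddCon.ker_rel _).2 hab

lemma isPresentation_of_forall {ρ : Set ((S.minGens →₀ ℕ) × (S.minGens →₀ ℕ))}
    (h : ρ ⊆ S.kerPairs)
    (h' : ∀ a b, S.eval a = S.eval b → addConGen (fun a b => (a, b) ∈ ρ) a b) :
    S.IsPresentation ρ :=
  le_antisymm (addConGen_le_ker h) fun {a b} hab => h' a b ((AddCon.ker_rel _).1 hab)

/-- A set of relations is a presentation as soon as every vector is congruent to a normal form and
distinct normal forms have distinct values. -/
lemma isPresentation_of_normalForms {ρ : Set ((S.minGens →₀ ℕ) × (S.minGens →₀ ℕ))}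
    {N : Set (S.minGens →₀ ℕ)} (h : ρ ⊆ S.kerPairs) (hN : Set.InjOn S.eval N)
    (hred : ∀ a, ∃ b ∈ N, addConGen (fun a b => (a, b) ∈ ρ) a b) : S.IsPresentation ρ := by
  refine isPresentation_of_forall h fun a b hab => ?_
  obtain ⟨a', ha', haa⟩ := hred a
  obtain ⟨b', hb', hbb⟩ := hred b
  have h1 : S.eval a = S.eval a' := (AddCon.ker_rel _).1 (addConGen_le_ker h haa)
  have h2 : S.eval b = S.eval b' := (AddCon.ker_rel _).1 (addConGen_le_ker h hbb)
  obtain rfl := hN ha' hb' (by omega)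
  exact AddCon.trans _ haa (AddCon.symm _ hbb)

section RationalRank

/-- Extension of scalars on exponent vectors. -/
noncomputable def toRat (S : NumericalSemigroup) : (S.minGens →₀ ℕ) →+ (S.minGens →₀ ℚ) :=
  Finsupp.mapRange.addMonoidHom (Nat.castAddMonoidHom ℚ)

lemma toRat_single (g : S.minGens) (n : ℕ) :
    S.toRat (Finsupp.single g n) = Finsupp.single g (n : ℚ) := by
  simp [toRat]

/-- Over `ℚ`, the differences of the relations and one further basis vector span the whole space:
the congruence `m e_g ∼ g e_{g₁}` puts every `e_g` in the span of `e_{g₁}` and the differences. -/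
lemma IsPresentation.embDim_le {ρ : Set ((S.minGens →₀ ℕ) × (S.minGens →₀ ℕ))}
    (h : S.IsPresentation ρ) : (S.embDim : ℕ∞) ≤ ρ.encard + 1 := by
  set D : Set (S.minGens →₀ ℚ) := (fun p => S.toRat p.1 - S.toRat p.2) '' ρ with hD
  set T := Submodule.span ℚ (insert (Finsupp.single S.fst 1) D) with hT
  have hle : addConGen (fun a b => (a, b) ∈ ρ) ≤
      AddCon.ker (T.mkQ.toAddMonoidHom.comp S.toRat) := by
    refine AddCon.addConGen_le.2 fun a b hab => (AddCon.ker_rel _).2 ?_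
    refine (Submodule.Quotient.eq T).2 (Submodule.subset_span (Or.inr ?_))
    exact ⟨(a, b), hab, rfl⟩
  have htop : T = ⊤ := by
    have hfst : Finsupp.single S.fst (1 : ℚ) ∈ T := Submodule.subset_span (Or.inl rfl)
    have hg : ∀ g, Finsupp.single g (1 : ℚ) ∈ T := fun g => by
      have hab : S.eval (Finsupp.single g S.multiplicity) = S.eval (Finsupp.single S.fst g) := by
        rw [eval_single, eval_single, coe_fst, mul_comm]
      have h1 := (Submodule.Quotient.eq T).1
        ((AddCon.ker_rel _).1 (hle (h.addConGen_of_eval_eq hab)))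
      rw [toRat_single, toRat_single] at h1
      have h2 := add_mem h1 (T.smul_mem ((g : ℕ) : ℚ) hfst)
      rw [Finsupp.smul_single, smul_eq_mul, mul_one, sub_add_cancel] at h2
      have h3 := T.smul_mem ((S.multiplicity : ℚ)⁻¹) h2
      rwa [Finsupp.smul_single, smul_eq_mul, inv_mul_cancel₀] at h3
      exact_mod_cast S.multiplicity_pos.ne'
    refine (Submodule.eq_top_iff').2 fun f => ?_
    induction f using Finsupp.induction_linear with
    | zero => exact zero_mem _
    | add f₁ f₂ h1 h2 => exact add_mem h1 h2
    | single g r =>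
      have := T.smul_mem r (hg g)
      rwa [Finsupp.smul_single, smul_eq_mul, mul_one] at this
  calc (S.embDim : ℕ∞) = (Module.rank ℚ (S.minGens →₀ ℚ)).toENat := by
        rw [rank_finsupp_self', Set.toENat_cardinalMk, embDim, S.minGens_finite.cast_ncard_eq]
    _ = (Module.rank ℚ T).toENat := by rw [htop, rank_top]
    _ ≤ (insert (Finsupp.single S.fst 1) D).encard := toENat_rank_span_le_encard _
    _ ≤ D.encard + 1 := Set.encard_insert_le _ _
    _ ≤ ρ.encard + 1 := by gcongr; exact Set.encard_image_le _ _

end RationalRank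

section Syzygies

/-- The span of the binomials whose two terms share a variable. -/
noncomputable def trivialBinomials (S : NumericalSemigroup) :
    Submodule ℚ ((S.minGens →₀ ℕ) →₀ ℚ) :=
  Submodule.span ℚ {f | ∃ a b : S.minGens →₀ ℕ, S.eval a = S.eval b ∧
    (∃ g, a g ≠ 0 ∧ b g ≠ 0) ∧ f = Finsupp.single a 1 - Finsupp.single b 1}

/-- The class of the binomial of a pair modulo `trivialBinomials`. -/
noncomputable def binomialClass (S : NumericalSemigroup)
    (p : (S.minGens →₀ ℕ) × (S.minGens →₀ ℕ)) :
    ((S.minGens →₀ ℕ) →₀ ℚ) ⧸ S.trivialBinomials :=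
  S.trivialBinomials.mkQ (Finsupp.single p.1 1 - Finsupp.single p.2 1)

lemma binomialClass_eq_zero {a b : S.minGens →₀ ℕ} (h : S.eval a = S.eval b) {g : S.minGens}
    (ha : a g ≠ 0) (hb : b g ≠ 0) : S.binomialClass (a, b) = 0 :=
  (Submodule.Quotient.mk_eq_zero _).2 (Submodule.subset_span ⟨a, b, h, ⟨g, ha, hb⟩, rfl⟩)

lemma binomialClass_add_binomialClass (a b c : S.minGens →₀ ℕ) :
    S.binomialClass (a, b) + S.binomialClass (b, c) = S.binomialClass (a, c) := by
  simp only [binomialClass, ← map_add, sub_add_sub_cancel]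

lemma binomialClass_swap (a b : S.minGens →₀ ℕ) :
    S.binomialClass (b, a) = - S.binomialClass (a, b) := by
  simp only [binomialClass, ← map_neg, neg_sub]

lemma binomialClass_self (a : S.minGens →₀ ℕ) : S.binomialClass (a, a) = 0 := by
  simp [binomialClass]

/-- A nontrivial translation creates a common variable. Hence generating a congruence reduces to
taking linear spans of classes. -/
lemma binomialClass_add_right {a b : S.minGens →₀ ℕ} (h : S.eval a = S.eval b)
    (c : S.minGens →₀ ℕ) : S.binomialClass (a + c, b + c) = 0 ∨
      S.binomialClass (a + c, b + c) = S.binomialClass (a, b) := by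
  by_cases hc : c = 0
  · right; rw [hc, add_zero, add_zero]
  · obtain ⟨g, hg⟩ := Finsupp.ne_iff.1 hc
    rw [Finsupp.zero_apply] at hg
    left
    exact binomialClass_eq_zero (g := g) (by simp [h]) (by simp [hg]) (by simp [hg])

lemma IsPresentation.binomialClass_mem_span {ρ : Set ((S.minGens →₀ ℕ) × (S.minGens →₀ ℕ))}
    (h : S.IsPresentation ρ) {a b : S.minGens →₀ ℕ} (hab : S.eval a = S.eval b) :
    S.binomialClass (a, b) ∈ Submodule.span ℚ (S.binomialClass '' ρ) := by
  set T := Submodule.span ℚ (S.binomialClass '' ρ)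
  have hadd : ∀ {a b} (c : S.minGens →₀ ℕ), S.eval a = S.eval b → S.binomialClass (a, b) ∈ T →
      S.binomialClass (a + c, b + c) ∈ T := fun c he hm => by
    rcases binomialClass_add_right he c with h0 | h0 <;> rw [h0]
    · exact zero_mem _
    · exact hm
  suffices H : ∀ a b, AddConGen.Rel (fun a b => (a, b) ∈ ρ) a b →
      S.eval a = S.eval b ∧ S.binomialClass (a, b) ∈ T from
    (H a b (h.addConGen_of_eval_eq hab)).2
  intro a b hr
  induction hr with
  | of a b hab => exact ⟨h.subset_kerPairs hab, Submodule.subset_span ⟨_, hab, rfl⟩⟩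
  | refl a => exact ⟨rfl, by rw [binomialClass_self]; exact zero_mem _⟩
  | symm _ ih => exact ⟨ih.1.symm, by rw [binomialClass_swap]; exact neg_mem ih.2⟩
  | trans _ _ ih1 ih2 =>
    exact ⟨ih1.1.trans ih2.1, by
      rw [← binomialClass_add_binomialClass]; exact add_mem ih1.2 ih2.2⟩
  | @add w x y z _ _ ih1 ih2 =>
    refine ⟨by rw [map_add, map_add, ih1.1, ih2.1], ?_⟩
    rw [← binomialClass_add_binomialClass _ (x + y)]
    refine add_mem (hadd y ih1.1 ih1.2) ?_
    rw [add_comm x y, add_comm x z]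
    exact hadd x ih2.1 ih2.2

/-- The Nakayama-type converse: spanning modulo binomials with a common variable is enough, because
a common variable can be cancelled and the value then drops. -/
lemma isPresentation_of_binomialClass_mem_span
    {ρ : Set ((S.minGens →₀ ℕ) × (S.minGens →₀ ℕ))} (h : ρ ⊆ S.kerPairs)
    (hspan : ∀ a b, S.eval a = S.eval b →
      S.binomialClass (a, b) ∈ Submodule.span ℚ (S.binomialClass '' ρ)) :
    S.IsPresentation ρ := by
  classical
  refine isPresentation_of_forall h fun a b hab => ?_
  set C := addConGen (fun a b => (a, b) ∈ ρ) with hC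
  have hker : ∀ {x y}, C x y → S.eval x = S.eval y := fun hxy =>
    (AddCon.ker_rel _).1 (addConGen_le_ker h hxy)
  induction hn : S.eval a using Nat.strong_induction_on generalizing a b with
  | _ n ih =>
    have hshare : ∀ {x y} {g : S.minGens}, S.eval x = n → S.eval y = n → x g ≠ 0 → y g ≠ 0 →
        C x y := by
      intro x y g hx hy hxg hyg
      obtain ⟨x', rfl⟩ := exists_add_of_le (a := Finsupp.single g 1) (b := x)
        (by rw [Finsupp.single_le_iff]; omega)
      obtain ⟨y', rfl⟩ := exists_add_of_le (a := Finsupp.single g 1) (b := y)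
        (by rw [Finsupp.single_le_iff]; omega)
      rw [map_add, eval_single] at hx hy
      have := gen_pos g
      exact C.add (C.refl _) (ih _ (by omega) x' y' (by omega) rfl)
    -- The indicator of the congruence class of `a` descends to the quotient by `hshare` and
    -- vanishes on the classes of `ρ`. It therefore vanishes on the class of `(a, b)`, which puts
    -- `b` in the class of `a`.
    set χ : ((S.minGens →₀ ℕ) →₀ ℚ) →ₗ[ℚ] ℚ :=
      Finsupp.linearCombination ℚ (fun x => if C x a then (1 : ℚ) else 0) with hχ
    have hχs : ∀ x, χ (Finsupp.single x 1) = if C x a then (1 : ℚ) else 0 := fun x => by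
      simp [hχ]
    have hχeq : ∀ x y, C x y → χ (Finsupp.single x 1 - Finsupp.single y 1) = 0 := by
      intro x y hxy
      have : C x a ↔ C y a := ⟨fun hx => C.trans (C.symm hxy) hx, fun hy => C.trans hxy hy⟩
      rw [map_sub, hχs, hχs, sub_eq_zero]
      simp only [this]
    have hN : S.trivialBinomials ≤ LinearMap.ker χ := by
      refine Submodule.span_le.2 ?_
      rintro _ ⟨x, y, hxy, ⟨g, hxg, hyg⟩, rfl⟩
      rw [SetLike.mem_coe, LinearMap.mem_ker]
      by_cases hx : S.eval x = n
      · exact hχeq x y (hshare hx (hxy ▸ hx) hxg hyg)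
      · rw [map_sub, hχs, hχs, if_neg fun hc => hx ((hker hc).trans hn),
          if_neg fun hc => hx (hxy.trans ((hker hc).trans hn)), sub_zero]
    have hT : Submodule.span ℚ (S.binomialClass '' ρ) ≤
        LinearMap.ker (S.trivialBinomials.liftQ χ hN) := by
      refine Submodule.span_le.2 ?_
      rintro _ ⟨⟨x, y⟩, hp, rfl⟩
      exact hχeq x y (AddConGen.Rel.of _ _ hp)
    have h0 : χ (Finsupp.single a 1 - Finsupp.single b 1) = 0 := hT (hspan a b hab)
    rw [map_sub, hχs, hχs, if_pos (C.refl a)] at h0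
    by_cases hb : C b a
    · exact C.symm hb
    · rw [if_neg hb] at h0
      norm_num at h0

/-- A relation whose class depends linearly on the others could be dropped by the spanning
criterion. -/
lemma IsMinimalPresentation.linearIndepOn {ρ : Set ((S.minGens →₀ ℕ) × (S.minGens →₀ ℕ))}
    (h : S.IsMinimalPresentation ρ) : LinearIndepOn ℚ S.binomialClass ρ := by
  rw [linearIndepOn_iff_notMem_span]
  intro p hp hmem
  have hle : Submodule.span ℚ (S.binomialClass '' ρ) ≤
      Submodule.span ℚ (S.binomialClass '' (ρ \ {p})) := by
    refine Submodule.span_le.2 ?_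
    rintro _ ⟨q, hq, rfl⟩
    by_cases hqp : q = p
    · rw [hqp]; exact hmem
    · exact Submodule.subset_span ⟨q, ⟨hq, hqp⟩, rfl⟩
  have hpres : S.IsPresentation (ρ \ {p}) := isPresentation_of_binomialClass_mem_span
    (Set.sdiff_subset.trans h.prop.subset_kerPairs)
    fun a b hab => hle (h.prop.binomialClass_mem_span hab)
  exact (h.le_of_le hpres Set.sdiff_subset hp).2 rfl

/-- Independent classes on one side, spanning classes on the other: compare dimensions. -/
lemma IsMinimalPresentation.encard_le {ρ ρ' : Set ((S.minGens →₀ ℕ) × (S.minGens →₀ ℕ))}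
    (h : S.IsMinimalPresentation ρ) (h' : S.IsPresentation ρ') : ρ.encard ≤ ρ'.encard := by
  have hle : Submodule.span ℚ (S.binomialClass '' ρ) ≤
      Submodule.span ℚ (S.binomialClass '' ρ') := by
    refine Submodule.span_le.2 ?_
    rintro _ ⟨p, hp, rfl⟩
    exact h'.binomialClass_mem_span (h.prop.subset_kerPairs hp)
  calc ρ.encard = (Module.rank ℚ (Submodule.span ℚ (S.binomialClass '' ρ))).toENat :=
        (toENat_rank_span_set h.linearIndepOn).symm
    _ ≤ (Module.rank ℚ (Submodule.span ℚ (S.binomialClass '' ρ'))).toENat :=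
        Cardinal.toENat.monotone' (Submodule.rank_mono hle)
    _ ≤ (S.binomialClass '' ρ').encard := toENat_rank_span_le_encard _
    _ ≤ ρ'.encard := Set.encard_image_le _ _

lemma IsPresentation.exists_isMinimalPresentation
    {ρ : Set ((S.minGens →₀ ℕ) × (S.minGens →₀ ℕ))} (h : S.IsPresentation ρ) (hfin : ρ.Finite) :
    ∃ ρ', S.IsMinimalPresentation ρ' := by
  obtain ⟨ρ', -, hmin⟩ := Set.Finite.exists_le_minimal
    (s := {σ | σ ⊆ ρ ∧ S.IsPresentation σ}) (a := ρ)
    (hfin.finite_subsets.subset fun σ hσ => hσ.1) ⟨subset_rfl, h⟩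
  exact ⟨ρ', hmin.prop.2, fun σ hσ hle => hmin.le_of_le ⟨hle.trans hmin.prop.1, hσ⟩ hle⟩

/-- A semigroup with a presentation of at most `ν - 1` relations is a complete intersection. -/
lemma IsPresentation.isCompleteIntersection {ρ : Set ((S.minGens →₀ ℕ) × (S.minGens →₀ ℕ))}
    (h : S.IsPresentation ρ) (hcard : ρ.encard + 1 ≤ S.embDim) : S.IsCompleteIntersection := by
  refine ⟨h.exists_isMinimalPresentation ?_, fun σ hσ => ?_⟩
  · rw [← Set.encard_lt_top_iff]
    refine lt_of_le_of_lt (le_self_add.trans hcard) (ENat.natCast_lt_top _)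
  · refine le_antisymm (le_trans ?_ hcard) hσ.prop.embDim_le
    exact add_le_add (hσ.encard_le h) le_rfl

end Syzygies

end NumericalSemigroup

/-! ### Normal forms in free semigroups -/

namespace NumericalSemigroup

variable {S : NumericalSemigroup}

lemma eq_single_of_eval_eq_coe {g : S.minGens} {a : S.minGens →₀ ℕ} (h : S.eval a = g) :
    a = Finsupp.single g 1 := by
  have h0 : a ≠ 0 := by
    rintro rfl
    exact (gen_pos g).ne (by simpa using h)
  obtain ⟨j, hj⟩ := Finsupp.ne_iff.1 h0
  rw [Finsupp.zero_apply] at hj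
  obtain ⟨r, rfl⟩ := exists_add_of_le (a := Finsupp.single j 1) (b := a)
    (by rw [Finsupp.single_le_iff]; omega)
  rw [map_add, eval_single, one_mul] at h
  have hjg : (j : ℕ) = g :=
    g.2.2.2 j (mem_of_mem_minGens j.2) (gen_pos j).ne' ⟨S.eval r, eval_mem r, by omega⟩
  obtain rfl : j = g := Subtype.ext hjg
  rw [eval_eq_zero_iff.1 (by omega : S.eval r = 0), add_zero]

lemma weight_le_degree_mul {σ : Type*} {w : σ → ℕ} {B : ℕ} {a : σ →₀ ℕ}
    (h : ∀ g, a g ≠ 0 → w g ≤ B) : Finsupp.weight w a ≤ a.degree * B := by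
  rw [Finsupp.weight_apply, Finsupp.degree_apply, Finset.sum_mul]
  exact Finset.sum_le_sum fun g hg =>
    Nat.mul_le_mul_left _ (h g (Finsupp.mem_support_iff.1 hg))

lemma exists_enumeration_lift {n : ℕ → ℕ}
    (hn : Set.BijOn n (Set.Icc 1 S.embDim) S.minGens) :
    ∃ (e : ℕ → S.minGens) (pos : S.minGens → ℕ), (∀ i ∈ Set.Icc 1 S.embDim, (e i : ℕ) = n i) ∧
      (∀ i ∈ Set.Icc 1 S.embDim, pos (e i) = i) ∧
      ∀ g, pos g ∈ Set.Icc 1 S.embDim ∧ e (pos g) = g := by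
  classical
  set e : ℕ → S.minGens := fun i => if h : n i ∈ S.minGens then ⟨n i, h⟩ else S.fst
  have he : ∀ i ∈ Set.Icc 1 S.embDim, (e i : ℕ) = n i := fun i hi => by
    simp only [e, dif_pos (hn.mapsTo hi)]
  have hs : ∀ g, ∃ i, i ∈ Set.Icc 1 S.embDim ∧ e i = g := fun g => by
    obtain ⟨i, hi, hig⟩ := hn.surjOn g.2
    exact ⟨i, hi, Subtype.ext ((he i hi).trans hig)⟩
  choose pos hpos using hs
  refine ⟨e, pos, he, fun i hi => ?_, hpos⟩
  refine hn.injOn (hpos _).1 hi ?_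
  rw [← he _ (hpos _).1, (hpos _).2, he i hi]

/-- A free semigroup has at most `ν - 1` relations rewriting every vector to a unique normal form,
in such a way that the last generator is never introduced. -/
lemma IsFree.exists_normalForms (h : S.IsFree) :
    ∃ (g : S.minGens) (ρ : Set ((S.minGens →₀ ℕ) × (S.minGens →₀ ℕ)))
      (N : Set (S.minGens →₀ ℕ)),
      ρ.encard + 1 ≤ S.embDim ∧ ρ ⊆ S.kerPairs ∧ Set.InjOn S.eval N ∧
      (∀ a, ∃ b ∈ N, addConGen (fun a b => (a, b) ∈ ρ) a b ∧ (a g = 0 → b g = 0)) ∧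
      (1 < S.embDim → ∀ b ∈ N, b g = 0 → b + Finsupp.single g 1 ∈ N) := by
  obtain ⟨n, hn, hAp⟩ := h
  obtain ⟨e, pos, he, hpe, hpos⟩ := exists_enumeration_lift hn
  set ν := S.embDim with hν
  have hν1 : 1 ≤ ν := S.embDim_pos
  have h1mem : 1 ∈ Set.Icc 1 ν := ⟨le_rfl, hν1⟩
  have hn1 : 0 < n 1 := pos_of_mem_minGens (hn.mapsTo h1mem)
  have hI : ∀ {i}, i ∈ Finset.Icc 2 ν → i ∈ Set.Icc 1 ν := fun {i} hi => by
    rw [Finset.mem_Icc] at hi; exact ⟨by omega, hi.2⟩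
  have hinj : ∀ {i j}, i ∈ Set.Icc 1 ν → j ∈ Set.Icc 1 ν → e i = e j → i = j :=
    fun {i j} hi hj hij => by rw [← hpe i hi, hij, hpe j hj]
  have hv : ∀ i, ∃ v : S.minGens →₀ ℕ, i ∈ Finset.Icc 2 ν →
      S.eval v = (phi n i + 1) * n i ∧ ∀ g, v g ≠ 0 → pos g < i := by
    intro i
    by_cases hi : i ∈ Finset.Icc 2 ν
    · have hi' := Finset.mem_Icc.1 hi
      obtain ⟨v, hv, hv'⟩ := (mem_closure_iff_exists_eval (S := S) (T := n '' Set.Ico 1 i) (by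
        rintro _ ⟨j, hj, rfl⟩
        exact hn.mapsTo ⟨hj.1, (hj.2.trans_le hi'.2).le⟩)).1 (phi_spec hn1 hi'.1)
      refine ⟨v, fun _ => ⟨hv, fun g hg => ?_⟩⟩
      obtain ⟨j, hj, hjg⟩ := hv' g hg
      have hj' : j ∈ Set.Icc 1 ν := ⟨hj.1, (hj.2.trans_le hi'.2).le⟩
      rw [← Subtype.ext ((he j hj').trans hjg), hpe j hj']
      exact hj.2
    · exact ⟨0, fun h => absurd h hi⟩
  choose v hv using hv
  -- `K` exceeds the degree of every `v i`. Under the weight `K ^ pos`, replacing a later generator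
  -- by `v i` therefore decreases the weight, and rewriting terminates.
  set K := 1 + ∑ i ∈ Finset.Icc 2 ν, (v i).degree with hK
  have hK0 : 0 < K := by omega
  set W : (S.minGens →₀ ℕ) →+ ℕ := Finsupp.weight (fun g => K ^ pos g) with hW
  have hWv : ∀ i ∈ Finset.Icc 2 ν, W (v i) < W (Finsupp.single (e i) (phi n i + 1)) := by
    intro i hi
    have hi1 : i - 1 + 1 = i := by have := (hI hi).1; omega
    have h1 : W (v i) ≤ (v i).degree * K ^ (i - 1) := weight_le_degree_mul fun g hg =>
      Nat.pow_le_pow_right hK0 (Nat.le_sub_one_of_lt ((hv i hi).2 g hg))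
    have h2 : (v i).degree < K := by
      have : (v i).degree ≤ ∑ i ∈ Finset.Icc 2 ν, (v i).degree :=
        Finset.single_le_sum (f := fun i => (v i).degree) (fun _ _ => Nat.zero_le _) hi
      omega
    have h3 : (v i).degree * K ^ (i - 1) < K ^ i := by
      conv_rhs => rw [← hi1, pow_succ, mul_comm]
      exact Nat.mul_lt_mul_of_pos_right h2 (pow_pos hK0 _)
    have h4 : W (Finsupp.single (e i) (phi n i + 1)) = (phi n i + 1) * K ^ i := by
      rw [hW, Finsupp.weight_single, hpe i (hI hi), smul_eq_mul]
    rw [h4]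
    nlinarith [pow_pos hK0 i]
  set ρ : Set ((S.minGens →₀ ℕ) × (S.minGens →₀ ℕ)) :=
    (fun i => (Finsupp.single (e i) (phi n i + 1), v i)) '' (Finset.Icc 2 ν : Set ℕ) with hρ
  -- The coordinate at the first generator is left free in normal forms.
  set N : Set (S.minGens →₀ ℕ) := {a | ∀ i ∈ Finset.Icc 2 ν, a (e i) ≤ phi n i} with hN
  have hker : ρ ⊆ S.kerPairs := by
    rintro _ ⟨i, hi, rfl⟩
    change S.eval _ = S.eval _
    rw [eval_single, (hv i hi).1, he i (hI hi)]
  have hev : ∀ {a b}, addConGen (fun a b => (a, b) ∈ ρ) a b → S.eval a = S.eval b :=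
    fun hab => (AddCon.ker_rel _).1 (addConGen_le_ker hker hab)
  have hstep : ∀ a, a ∉ N → ∃ b, W b < W a ∧ addConGen (fun a b => (a, b) ∈ ρ) a b ∧
      (a (e ν) = 0 → b (e ν) = 0) := by
    intro a ha
    have : ∃ i ∈ Finset.Icc 2 ν, phi n i < a (e i) := by
      by_contra! hc
      exact ha hc
    obtain ⟨i, hi, hlt⟩ := this
    obtain ⟨r, rfl⟩ := exists_add_of_le (a := Finsupp.single (e i) (phi n i + 1)) (b := a)
      (by rw [Finsupp.single_le_iff]; omega)
    refine ⟨v i + r, ?_, ?_, fun h0 => ?_⟩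
    · rw [map_add, map_add]
      exact Nat.add_lt_add_right (hWv i hi) _
    · exact AddCon.add _ (AddConGen.Rel.of _ _ ⟨i, hi, rfl⟩) (AddCon.refl _ _)
    · rw [Finsupp.add_apply] at h0 ⊢
      by_cases hvν : v i (e ν) = 0
      · omega
      · have := (hv i hi).2 _ hvν
        rw [hpe ν ⟨hν1, le_rfl⟩] at this
        have := (Finset.mem_Icc.1 hi).2
        omega
  have hred : ∀ a, ∃ b ∈ N, addConGen (fun a b => (a, b) ∈ ρ) a b ∧
      (a (e ν) = 0 → b (e ν) = 0) := by
    intro a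
    induction hw : W a using Nat.strong_induction_on generalizing a with
    | _ w ih =>
      by_cases ha : a ∈ N
      · exact ⟨a, ha, AddCon.refl _ a, id⟩
      · obtain ⟨b, hb, hab, h0⟩ := hstep a ha
        obtain ⟨c, hc, hbc, h0'⟩ := ih (W b) (hw ▸ hb) b rfl
        exact ⟨c, hc, AddCon.trans _ hab hbc, h0' ∘ h0⟩
  set Φ : S.minGens →₀ ℕ := ∑ i ∈ Finset.Icc 2 ν, Finsupp.single (e i) (phi n i) with hΦ
  have hΦA : S.eval Φ ∈ S.aperyAt (e 1) := by
    rw [he 1 h1mem]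
    refine hAp.ge ⟨phi n, fun i _ => le_rfl, ?_⟩
    rw [hΦ, map_sum]
    exact Finset.sum_congr rfl fun i hi => by rw [eval_single, he i (hI hi)]
  have hΦi : ∀ i ∈ Finset.Icc 2 ν, Φ (e i) = phi n i := by
    intro i hi
    rw [hΦ, Finsupp.finsetSum_apply, Finset.sum_eq_single i, Finsupp.single_eq_same]
    · intro j hj hji
      rw [Finsupp.single_apply, if_neg fun hc => hji (hinj (hI hj) (hI hi) hc)]
    · exact fun hc => absurd hi hc
  have hle : ∀ a ∈ N, a (e 1) = 0 → a ≤ Φ := by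
    intro a ha h0 g
    obtain ⟨hg1, hg2⟩ := hpos g
    rw [← hg2]
    by_cases hp : pos g = 1
    · rw [hp, h0]; exact Nat.zero_le _
    · have hp2 : pos g ∈ Finset.Icc 2 ν := Finset.mem_Icc.2 ⟨by have := hg1.1; omega, hg1.2⟩
      rw [hΦi _ hp2]
      exact ha _ hp2
  -- A representation of `eval Φ` of least weight is irreducible, hence in `N`. It avoids `n 1`
  -- because the value is in the Apéry set, so it lies below `Φ` and equals it. Thus `Φ` is the
  -- unique minimiser, and `hU` passes uniqueness on to its subvectors.
  have hmin : ∀ c, S.eval c = S.eval Φ → (∀ d, S.eval d = S.eval Φ → W c ≤ W d) → c = Φ := by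
    intro c hc hcd
    have hcN : c ∈ N := by
      by_contra hc'
      obtain ⟨b, hb, hcb, -⟩ := hstep c hc'
      exact (hcd b ((hev hcb).symm.trans hc)).not_gt hb
    exact eval_injOn_le (hle c hcN (apply_eq_zero_of_eval_mem_aperyAt (hc ▸ hΦA))) hc
  have hΦmin : ∀ d, S.eval d = S.eval Φ → W Φ ≤ W d := by
    obtain ⟨c, hc, hcmin⟩ := (S.finite_reps (S.eval Φ)).exists_minimalFor W _ ⟨Φ, rfl⟩
    have hcd : ∀ d, S.eval d = S.eval Φ → W c ≤ W d := fun d hd =>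
      (le_total (W c) (W d)).elim id fun hdc => hcmin hd hdc
    rw [← hmin c hc hcd]
    intro d hd
    exact hcd d (hd.trans (congrArg S.eval (hmin c hc hcd)))
  have hUle : ∀ {a b}, a ≤ Φ → S.eval a = S.eval b → W a ≤ W b := by
    intro a b ha hab
    obtain ⟨r, hr⟩ := exists_add_of_le ha
    have h1 := hΦmin (b + r) (by rw [hr, map_add, map_add, hab])
    rw [hr, map_add, map_add] at h1
    omega
  have hU : ∀ {a b}, a ≤ Φ → b ≤ Φ → S.eval a = S.eval b → a = b := by
    intro a b ha hb hab
    have hWab := le_antisymm (hUle ha hab) (hUle hb hab.symm)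
    obtain ⟨r, hr⟩ := exists_add_of_le ha
    have hbr : S.eval (b + r) = S.eval Φ := by rw [hr, map_add, map_add, hab]
    have h1 := hmin (b + r) hbr fun d hd => by
      have := hΦmin d hd
      rw [hr, map_add] at this
      rw [map_add, ← hWab]
      exact this
    rw [hr] at h1
    exact (add_right_cancel h1).symm
  have herase : ∀ a ∈ N, a.erase (e 1) ≤ Φ := fun a ha => hle _ (fun i hi =>
    le_trans (by rw [Finsupp.erase_apply]; split_ifs <;> simp) (ha i hi)) Finsupp.erase_same
  have hA : ∀ a ∈ N, S.eval (a.erase (e 1)) ∈ S.aperyAt (e 1) := fun a ha =>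
    eval_mem_aperyAt_of_le (herase a ha) hΦA
  have hsplit : ∀ a, S.eval a = a (e 1) * e 1 + S.eval (a.erase (e 1)) := fun a => by
    rw [← eval_single, ← map_add, Finsupp.single_add_erase]
  -- Away from `n 1` a normal form evaluates into `Ap(S, n 1)`, so the multiplicity of `n 1` is
  -- determined by the value.
  have hcoef : ∀ a ∈ N, ∀ b ∈ N, S.eval a = S.eval b → ¬ a (e 1) < b (e 1) := by
    intro a ha b hb hab hlt
    rw [hsplit a, hsplit b] at hab
    obtain ⟨t, ht⟩ := Nat.exists_eq_add_of_lt hlt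
    refine (hA a ha).2 ⟨t * e 1 + S.eval (b.erase (e 1)),
      add_mem (nsmul_mem (mem_of_mem_minGens (e 1).2) t) (eval_mem _), ?_⟩
    rw [ht] at hab
    linarith
  have hNinj : Set.InjOn S.eval N := by
    intro a ha b hb hab
    have h1 : a (e 1) = b (e 1) :=
      le_antisymm (not_lt.1 (hcoef b hb a ha hab.symm)) (not_lt.1 (hcoef a ha b hb hab))
    have h2 : a.erase (e 1) = b.erase (e 1) := by
      refine hU (herase a ha) (herase b hb) ?_
      rw [hsplit a, hsplit b, h1] at hab
      omega
    rw [← Finsupp.single_add_erase (e 1) a, ← Finsupp.single_add_erase (e 1) b, h1, h2]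
  refine ⟨e ν, ρ, N, ?_, hker, hNinj, hred, fun hlt b hb h0 i hi => ?_⟩
  · have : ρ.encard ≤ ((ν - 1 : ℕ) : ℕ∞) := by
      refine (Set.encard_image_le _ _).trans ?_
      rw [Set.encard_coe_eq_coe_finsetCard, Nat.card_Icc]
      exact_mod_cast (by omega : ν + 1 - 2 ≤ ν - 1)
    calc ρ.encard + 1 ≤ ((ν - 1 : ℕ) : ℕ∞) + 1 := add_le_add this le_rfl
      _ = (ν : ℕ∞) := by exact_mod_cast (by omega : ν - 1 + 1 = ν)
  · rw [Finsupp.add_apply]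
    by_cases hiν : i = ν
    · subst hiν
      rw [h0, Finsupp.single_eq_same]
      by_contra hc
      -- If `φ_ν = 0`, the last generator would lie in the monoid generated by the others, against
      -- its minimality. So one copy of it always fits in a normal form.
      have hz : phi n ν = 0 := by omega
      have h1 := (hv ν hi).1
      rw [hz, zero_add, one_mul, ← he ν (hI hi)] at h1
      have h2 := (hv ν hi).2 (e ν) (by rw [eq_single_of_eval_eq_coe h1]; simp)
      rw [hpe ν (hI hi)] at h2
      omega
    · rw [Finsupp.single_apply, if_neg fun hc => hiν (hinj ⟨hν1, le_rfl⟩ (hI hi) hc).symm]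
      exact hb i hi

lemma IsFree.isCompleteIntersection (h : S.IsFree) : S.IsCompleteIntersection := by
  obtain ⟨g, ρ, N, hcard, hker, hN, hred, -⟩ := h.exists_normalForms
  refine (isPresentation_of_normalForms hker hN fun a => ?_).isCompleteIntersection hcard
  obtain ⟨b, hb, hab, -⟩ := hred a
  exact ⟨b, hb, hab⟩

/-- In a free semigroup the last generator is not in the group generated by the others. -/
lemma IsFree.exists_forall_eval_add_ne (h : S.IsFree) (hd : 1 < S.embDim) :
    ∃ g : S.minGens, ∀ x y : S.minGens →₀ ℕ, x g = 0 → y g = 0 → S.eval x + g ≠ S.eval y := by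
  obtain ⟨g, ρ, N, -, hker, hN, hred, hlast⟩ := h.exists_normalForms
  refine ⟨g, fun x y hx hy hxy => ?_⟩
  obtain ⟨x', hx', hxx, hx0⟩ := hred x
  obtain ⟨y', hy', hyy, hy0⟩ := hred y
  have h1 : S.eval x = S.eval x' := (AddCon.ker_rel _).1 (addConGen_le_ker hker hxx)
  have h2 : S.eval y = S.eval y' := (AddCon.ker_rel _).1 (addConGen_le_ker hker hyy)
  -- Both `x' + e_g` and `y'` are normal forms with the same value, yet their coordinates at `g` are
  -- `1` and `0`.
  have h3 := hN (hlast hd x' hx' (hx0 hx)) hy' (by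
    rw [map_add, eval_single, one_mul, ← h1, ← h2, hxy])
  have h4 := DFunLike.congr_fun h3 g
  rw [Finsupp.add_apply, hx0 hx, hy0 hy, Finsupp.single_eq_same] at h4
  omega

end NumericalSemigroup

/-! ### Semigroups given by explicit generators -/

namespace NumericalSemigroup

section Generators

variable {n : ℕ} {p : Fin (n + 1) → ℕ}

/-- The numerical semigroup generated by the values of `p`, given that it contains `m > 0` and `m`
consecutive integers starting at `N`. -/
def ofGens (p : Fin (n + 1) → ℕ) (N m : ℕ) (hm0 : 0 < m)
    (hm : ∃ x : Fin (n + 1) → ℕ, ∑ i, x i * p i = m)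
    (hN : ∀ s, N ≤ s → s < N + m → ∃ x : Fin (n + 1) → ℕ, ∑ i, x i * p i = s) :
    NumericalSemigroup where
  carrier := {s | ∃ x : Fin (n + 1) → ℕ, ∑ i, x i * p i = s}
  zero_mem' := ⟨0, by simp⟩
  add_mem' := by
    rintro _ _ ⟨x, rfl⟩ ⟨y, rfl⟩
    exact ⟨x + y, by simp [add_mul, Finset.sum_add_distrib]⟩
  finite_compl := by
    refine (Set.finite_Iio N).subset fun s hs => ?_
    by_contra hsN
    rw [Set.mem_Iio, not_lt] at hsN
    apply hs
    clear hs
    induction s using Nat.strong_induction_on with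
    | _ s ih =>
      by_cases hlt : s < N + m
      · exact hN s hsN hlt
      · obtain ⟨y, hy⟩ := hm
        obtain ⟨x, hx⟩ := ih (s - m) (by omega) (by omega)
        refine ⟨x + y, ?_⟩
        simp only [Pi.add_apply, add_mul, Finset.sum_add_distrib, hx, hy]
        omega

/-- An identification of the minimal generators of `S` with the values of `p`, the first of which is
the multiplicity. -/
structure Generators (S : NumericalSemigroup) (p : Fin (n + 1) → ℕ) where
  toEquiv : Fin (n + 1) ≃ S.minGens
  coe_toEquiv : ∀ i, (toEquiv i : ℕ) = p i
  toEquiv_zero : toEquiv 0 = S.fst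

lemma nonempty_generators_ofGens {N m : ℕ} {hm0 : 0 < m}
    {hm : ∃ x : Fin (n + 1) → ℕ, ∑ i, x i * p i = m}
    {hN : ∀ s, N ≤ s → s < N + m → ∃ x : Fin (n + 1) → ℕ, ∑ i, x i * p i = s}
    (hpos : ∀ i, 0 < p i) (hmin : ∀ i, ∀ x : Fin (n + 1) → ℕ, x i = 0 → ∑ j, x j * p j ≠ p i)
    (h0 : ∀ i, p 0 ≤ p i) : Nonempty (Generators (ofGens p N m hm0 hm hN) p) := by
  classical
  set S := ofGens p N m hm0 hm hN
  have hle : ∀ (x : Fin (n + 1) → ℕ) i, x i ≠ 0 → p i ≤ ∑ j, x j * p j := fun x i hx =>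
    (Nat.le_mul_of_pos_left _ (Nat.pos_of_ne_zero hx)).trans
      (Finset.single_le_sum (f := fun j => x j * p j) (fun _ _ => Nat.zero_le _)
        (Finset.mem_univ i))
  have hsingle : ∀ i, ∑ j, (Pi.single i 1 : Fin (n + 1) → ℕ) j * p j = p i := fun i => by
    simp [Pi.single_apply]
  have hinj : Function.Injective p := by
    intro i j hij
    by_contra hne
    exact hmin i (Pi.single j 1) (Pi.single_eq_of_ne hne _) (by rw [hsingle, hij])
  have hmem : ∀ i, p i ∈ S.minGens := by
    refine fun i => ⟨⟨Pi.single i 1, hsingle i⟩, (hpos i).ne', ?_⟩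
    rintro _ ⟨x, rfl⟩ hx0 ⟨_, ⟨y, rfl⟩, hxy⟩
    by_contra hne
    have hx : x i = 0 := by
      by_contra hx
      have := hle x i hx
      omega
    have hy : y i = 0 := by
      by_contra hy
      have := hle y i hy
      omega
    exact hmin i (y + x) (by simp [hx, hy]) (by
      simp only [Pi.add_apply, add_mul, Finset.sum_add_distrib]; exact hxy.symm)
  have hsurj : ∀ g ∈ S.minGens, ∃ i, p i = g := by
    rintro _ ⟨⟨x, rfl⟩, hx0, hg⟩
    have : ∃ i, x i ≠ 0 := by
      by_contra! hc
      exact hx0 (by simp [hc])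
    obtain ⟨i, hi⟩ := this
    refine ⟨i, hg (p i) ⟨Pi.single i 1, hsingle i⟩ (hpos i).ne'
      ⟨_, ⟨x - Pi.single i 1, rfl⟩, ?_⟩⟩
    conv_rhs => rw [← hsingle i, ← Finset.sum_add_distrib]
    refine Finset.sum_congr rfl fun j _ => ?_
    rw [← add_mul, Pi.sub_apply]
    by_cases hj : j = i
    · subst hj; rw [Pi.single_eq_same, Nat.sub_add_cancel (Nat.pos_of_ne_zero hi)]
    · rw [Pi.single_eq_of_ne hj]; simp
  refine ⟨⟨Equiv.ofBijective (fun i => ⟨p i, hmem i⟩)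
    ⟨fun i j hij => hinj (congrArg Subtype.val hij), fun g => ?_⟩, fun i => rfl, ?_⟩⟩
  · obtain ⟨i, hi⟩ := hsurj g g.2
    exact ⟨i, Subtype.ext hi⟩
  · apply Subtype.ext
    change p 0 = S.multiplicity
    obtain ⟨i, hi⟩ := hsurj _ S.multiplicity_mem_minGens
    exact le_antisymm (hi ▸ h0 i) (multiplicity_le (hmem 0).1 (hpos 0).ne')

namespace Generators

variable {S : NumericalSemigroup} (G : Generators S p)

/-- The exponent vector with the given coordinates. -/
noncomputable def vec (x : Fin (n + 1) → ℕ) : S.minGens →₀ ℕ :=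
  Finsupp.equivFunOnFinite.symm (x ∘ G.toEquiv.symm)

@[simp] lemma vec_apply (x : Fin (n + 1) → ℕ) (i : Fin (n + 1)) : G.vec x (G.toEquiv i) = x i := by
  simp [vec]

lemma vec_coords (a : S.minGens →₀ ℕ) : G.vec (fun i => a (G.toEquiv i)) = a := by
  ext g; simp [vec]

lemma exists_vec_eq (a : S.minGens →₀ ℕ) : ∃ x, G.vec x = a := ⟨_, G.vec_coords a⟩

lemma vec_add (x y : Fin (n + 1) → ℕ) : G.vec (x + y) = G.vec x + G.vec y := by
  ext g; simp [vec]

lemma single_eq_vec (i : Fin (n + 1)) (h : ℕ) :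
    Finsupp.single (G.toEquiv i) h = G.vec (Pi.single i h) := by
  classical
  ext g
  obtain ⟨j, rfl⟩ := G.toEquiv.surjective g
  simp [Finsupp.single_apply, Pi.single_apply, eq_comm]

lemma eval_vec (x : Fin (n + 1) → ℕ) : S.eval (G.vec x) = ∑ i, x i * p i := by
  have := Fintype.ofFinite S.minGens
  rw [eval, Finsupp.weight_eq_sum, ← G.toEquiv.sum_comp]
  simp [G.coe_toEquiv]

lemma degree_vec (x : Fin (n + 1) → ℕ) : (G.vec x).degree = ∑ i, x i := by
  have := Fintype.ofFinite S.minGens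
  rw [Finsupp.degree_eq_sum, ← G.toEquiv.sum_comp]
  simp

include G

lemma multiplicity_eq : S.multiplicity = p 0 := by
  rw [← coe_fst, ← G.toEquiv_zero, G.coe_toEquiv]

lemma mem_minGens (i : Fin (n + 1)) : p i ∈ S.minGens := G.coe_toEquiv i ▸ (G.toEquiv i).2

lemma embDim_eq : S.embDim = n + 1 := by
  rw [embDim, ← Nat.card_coe_set_eq, ← Nat.card_congr G.toEquiv, Nat.card_fin]

lemma exists_eq_of_mem_minGens {g : ℕ} (hg : g ∈ S.minGens) : ∃ i, p i = g := by
  obtain ⟨i, hi⟩ := G.toEquiv.surjective ⟨g, hg⟩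
  exact ⟨i, by rw [← G.coe_toEquiv, hi]⟩

lemma ne_multiplicity {i : Fin (n + 1)} (hi : i ≠ 0) : p i ≠ S.multiplicity := fun h =>
  hi (G.toEquiv.injective (by
    rw [G.toEquiv_zero, ← coe_eq_multiplicity_iff, G.coe_toEquiv, h]))

lemma mem_iff {s : ℕ} : s ∈ S ↔ ∃ x : Fin (n + 1) → ℕ, ∑ i, x i * p i = s := by
  constructor
  · intro hs
    obtain ⟨a, rfl⟩ := exists_eval_eq hs
    obtain ⟨x, rfl⟩ := G.exists_vec_eq a
    exact ⟨x, (G.eval_vec x).symm⟩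
  · rintro ⟨x, rfl⟩
    rw [← G.eval_vec]; exact eval_mem _

lemma mem_aperyAt {m : ℕ} (y : Fin (n + 1) → ℕ)
    (h : ∀ x : Fin (n + 1) → ℕ, ∑ i, x i * p i + m ≠ ∑ i, y i * p i) :
    ∑ i, y i * p i ∈ S.aperyAt m := by
  refine ⟨G.mem_iff.2 ⟨y, rfl⟩, ?_⟩
  rintro ⟨t, ht, hs⟩
  obtain ⟨x, rfl⟩ := G.mem_iff.1 ht
  exact h x hs

lemma mem_apery (y : Fin (n + 1) → ℕ)
    (h : ∀ x : Fin (n + 1) → ℕ, ∑ i, x i * p i + p 0 ≠ ∑ i, y i * p i) :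
    ∑ i, y i * p i ∈ S.apery := by
  rw [apery, G.multiplicity_eq]; exact G.mem_aperyAt y h

lemma mul_mem_apery {i : Fin (n + 1)} {h : ℕ}
    (hx : ∀ x : Fin (n + 1) → ℕ, ∑ i, x i * p i + p 0 ≠ h * p i) : h * p i ∈ S.apery := by
  have : ∑ j, (Pi.single i h : Fin (n + 1) → ℕ) j * p j = h * p i := by simp [Pi.single_apply]
  rw [← this] at hx ⊢
  exact G.mem_apery _ hx

lemma notMem_apery {s : ℕ} (x : Fin (n + 1) → ℕ) (h : ∑ i, x i * p i + p 0 = s) :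
    s ∉ S.apery := fun hs => hs.2 ⟨_, G.mem_iff.2 ⟨x, rfl⟩, by rw [G.multiplicity_eq, h]⟩

/-- Upper bounds on the constants suffice here, since the reverse inclusion holds for every
semigroup. What remains is linear arithmetic. -/
lemma box_subset_apery {c : ℕ → ℕ} (d : Fin (n + 1) → ℕ) (hc : ∀ i, i ≠ 0 → c (p i) ≤ d i)
    (hd : ∀ x y : Fin (n + 1) → ℕ, x 0 = 0 → (∀ i, i ≠ 0 → x i ≤ d i) →
      ∑ i, y i * p i + p 0 ≠ ∑ i, x i * p i) : S.box c ⊆ S.apery := by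
  rintro s ⟨a, rfl, ha⟩
  obtain ⟨x, rfl⟩ := G.exists_vec_eq a
  rw [G.eval_vec]
  refine G.mem_apery x fun y => hd x y ?_ fun i hi => ?_
  · rw [← G.vec_apply x]
    exact (ha _).1 (by rw [G.toEquiv_zero, coe_fst])
  · rw [← G.vec_apply x]
    refine ((ha _).2 ?_).trans ?_
    · rw [G.coe_toEquiv]; exact G.ne_multiplicity hi
    · rw [G.coe_toEquiv]; exact hc i hi

lemma mem_box {c : ℕ → ℕ} (x : Fin (n + 1) → ℕ) (h0 : x 0 = 0)
    (hx : ∀ i, i ≠ 0 → x i ≤ c (p i)) : ∑ i, x i * p i ∈ S.box c := by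
  refine ⟨G.vec x, G.eval_vec x, fun g => ?_⟩
  obtain ⟨i, rfl⟩ := G.toEquiv.surjective g
  rw [G.coe_toEquiv, G.vec_apply]
  refine ⟨fun hi => ?_, fun hi => hx i ?_⟩
  · by_cases h : i = 0
    · rw [h, h0]
    · exact absurd hi (G.ne_multiplicity h)
  · rintro rfl
    exact hi G.multiplicity_eq.symm

/-- A point of the box outside the Apéry set. -/
lemma apery_ne_box {c : ℕ → ℕ} (x y : Fin (n + 1) → ℕ) (h0 : x 0 = 0)
    (hx : ∀ i, i ≠ 0 → x i ≤ c (p i)) (hy : ∑ i, y i * p i + p 0 = ∑ i, x i * p i) :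
    S.apery ≠ S.box c := fun h =>
  G.notMem_apery y hy (h.ge (G.mem_box x h0 hx))

lemma tau_le {i : Fin (n + 1)} {c : ℕ} (x : Fin (n + 1) → ℕ)
    (hx : ∑ j, x j * p j = (c + 1) * p i) (hlt : ∀ j, x j ≠ 0 → p j < p i) : S.tau (p i) ≤ c := by
  have : sInf {h | 0 < h ∧ h * p i ∈ AddSubmonoid.closure {x | x ∈ S.minGens ∧ x < p i}} ≤
      c + 1 := by
    refine Nat.sInf_le ⟨Nat.succ_pos c, ?_⟩
    rw [← hx]
    refine sum_mem fun j _ => ?_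
    by_cases hj : x j = 0
    · rw [hj, zero_mul]; exact zero_mem _
    · refine nsmul_mem (AddSubmonoid.subset_closure ?_) (x j)
      exact ⟨G.mem_minGens j, hlt j hj⟩
  unfold tau
  omega

lemma le_tau {i : Fin (n + 1)} {c : ℕ} (hi : i ≠ 0)
    (h : ∀ (h : ℕ) (x : Fin (n + 1) → ℕ), 0 < h → h ≤ c → (∀ j, p i ≤ p j → x j = 0) →
      ∑ j, x j * p j ≠ h * p i) : c ≤ S.tau (p i) := by
  by_contra! hlt
  obtain ⟨a, ha, ha'⟩ := (mem_closure_iff_exists_eval (fun x hx => hx.1)).1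
    (tau_spec (G.mem_minGens i) (G.ne_multiplicity hi))
  obtain ⟨x, rfl⟩ := G.exists_vec_eq a
  rw [G.eval_vec] at ha
  refine h _ x (Nat.succ_pos _) hlt (fun j hj => ?_) ha
  by_contra hxj
  have := (ha' (G.toEquiv j) (by rwa [G.vec_apply])).2
  rw [G.coe_toEquiv] at this
  omega

lemma alpha_le {i : Fin (n + 1)} {c : ℕ} (x : Fin (n + 1) → ℕ)
    (hx : ∑ j, x j * p j + p 0 = (c + 1) * p i) : S.alpha (p i) ≤ c := by
  by_contra! hlt
  have hp := pos_of_mem_minGens (G.mem_minGens i)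
  have hA := alpha_mul_mem_apery (S := S) hp
  obtain ⟨t, ht⟩ := Nat.exists_eq_add_of_lt hlt
  rw [ht, show c + t + 1 = (c + 1) + t by ring, add_mul] at hA
  exact G.notMem_apery x hx (left_mem_aperyAt
    (nsmul_mem (G.mem_minGens i).1 (c + 1)) (nsmul_mem (G.mem_minGens i).1 t) hA)

lemma le_alpha {i : Fin (n + 1)} {h : ℕ}
    (hx : ∀ x : Fin (n + 1) → ℕ, ∑ i, x i * p i + p 0 ≠ h * p i) : h ≤ S.alpha (p i) :=
  le_csSup (bddAbove_alpha (pos_of_mem_minGens (G.mem_minGens i))) (G.mul_mem_apery hx)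

lemma ord_mul_eq {i : Fin (n + 1)} {h : ℕ}
    (hd : ∀ x : Fin (n + 1) → ℕ, ∑ i, x i * p i = h * p i → ∑ i, x i ≤ h) :
    S.ord (h * p i) = h := by
  refine le_antisymm (ord_le fun a ha => ?_) ?_
  · obtain ⟨x, rfl⟩ := G.exists_vec_eq a
    rw [G.eval_vec] at ha
    rw [G.degree_vec]
    exact hd x ha
  · have := degree_le_ord (Finsupp.single (G.toEquiv i) h)
    rwa [Finsupp.degree_single, eval_single, G.coe_toEquiv] at this

lemma le_beta {i : Fin (n + 1)} {h : ℕ}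
    (hx : ∀ x : Fin (n + 1) → ℕ, ∑ i, x i * p i + p 0 ≠ h * p i)
    (hd : ∀ x : Fin (n + 1) → ℕ, ∑ i, x i * p i = h * p i → ∑ i, x i ≤ h) : h ≤ S.beta (p i) :=
  le_csSup (bddAbove_beta (pos_of_mem_minGens (G.mem_minGens i)))
    ⟨G.mul_mem_apery hx, G.ord_mul_eq hd⟩

lemma le_gamma {i : Fin (n + 1)} {h : ℕ}
    (hx : ∀ x : Fin (n + 1) → ℕ, ∑ i, x i * p i + p 0 ≠ h * p i)
    (hu : ∀ x : Fin (n + 1) → ℕ, ∑ i, x i * p i = h * p i → x = Pi.single i h) :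
    h ≤ S.gamma (p i) := by
  have ho : S.ord (h * p i) = h := G.ord_mul_eq fun x hx => by
    rw [hu x hx]; simp
  refine le_csSup (bddAbove_gamma (pos_of_mem_minGens (G.mem_minGens i)))
    ⟨G.mul_mem_apery hx, ho, G.vec (Pi.single i h), ⟨?_, ?_⟩, ?_⟩
  · rw [← G.single_eq_vec, eval_single, G.coe_toEquiv]
  · rw [← G.single_eq_vec, Finsupp.degree_single, ho]
  · rintro a ⟨ha, -⟩
    obtain ⟨x, rfl⟩ := G.exists_vec_eq a
    rw [G.eval_vec] at ha
    rw [hu x ha]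

/-- Adding copies of `p i` to `x` gives a second representation of `γ p_i` with degree at least `γ`,
contradicting uniqueness of the maximal one. -/
lemma gamma_le {i : Fin (n + 1)} {c : ℕ} (x : Fin (n + 1) → ℕ)
    (hx : ∑ j, x j * p j = (c + 1) * p i) (hd : c + 1 ≤ ∑ j, x j) (hne : x i ≠ c + 1) :
    S.gamma (p i) ≤ c := by
  by_contra! hlt
  obtain ⟨-, ho, hu⟩ := gamma_spec (S := S) (pos_of_mem_minGens (G.mem_minGens i))
  set γ := S.gamma (p i)
  set a := G.vec x + Finsupp.single (G.toEquiv i) (γ - (c + 1)) with ha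
  have hea : S.eval a = γ * p i := by
    rw [ha, map_add, eval_single, G.eval_vec, hx, G.coe_toEquiv, ← add_mul,
      Nat.add_sub_cancel' hlt]
  have hda : a.degree = S.ord (γ * p i) := by
    refine le_antisymm (hea ▸ degree_le_ord a) ?_
    rw [ho, ha, map_add, Finsupp.degree_single, G.degree_vec]
    omega
  have := hu.unique ⟨hea, hda⟩ (y₂ := Finsupp.single (G.toEquiv i) γ)
    ⟨by rw [eval_single, G.coe_toEquiv], by rw [Finsupp.degree_single, ho]⟩
  have h1 := DFunLike.congr_fun this (G.toEquiv i)
  rw [ha, Finsupp.add_apply, Finsupp.single_eq_same, Finsupp.single_eq_same, G.vec_apply] at h1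
  omega

lemma isCritical {i : Fin (n + 1)} {c : ℕ} (hc : 0 < c) (x : Fin (n + 1) → ℕ)
    (hx : ∑ j, x j * p j = c * p i) (hxi : x i = 0)
    (hmin : ∀ (h : ℕ) (y : Fin (n + 1) → ℕ), 0 < h → h < c → y i = 0 →
      ∑ j, y j * p j ≠ h * p i) : S.IsCritical (G.toEquiv i) c := by
  refine ⟨hc, ⟨G.vec x, by rw [G.eval_vec, hx, G.coe_toEquiv], by rw [G.vec_apply, hxi]⟩, ?_⟩
  intro h h0 hlt u hu hui
  obtain ⟨y, rfl⟩ := G.exists_vec_eq u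
  rw [G.eval_vec, G.coe_toEquiv] at hu
  rw [G.vec_apply] at hui
  exact hmin h y h0 hlt hui hu

end Generators

end Generators

end NumericalSemigroup

/-! ### The semigroups used as counterexamples -/

namespace NumericalSemigroup

/-- The semigroup `⟨4, 6, 7⟩`. -/
def semigroup_4_6_7 : NumericalSemigroup :=
  ofGens ![4, 6, 7] 10 4 (by norm_num) ⟨![1, 0, 0], rfl⟩ (by
    intro s h1 h2
    interval_cases s
    · exact ⟨![1, 1, 0], rfl⟩
    · exact ⟨![1, 0, 1], rfl⟩
    · exact ⟨![3, 0, 0], rfl⟩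
    · exact ⟨![0, 1, 1], rfl⟩)

lemma nonempty_generators_semigroup_4_6_7 :
    Nonempty (Generators semigroup_4_6_7 ![4, 6, 7]) :=
  nonempty_generators_ofGens (by simp [Fin.forall_fin_succ])
    (by
      simp only [Fin.forall_fin_succ, Fin.sum_univ_succ]
      simp
      refine ⟨?_, ?_, ?_⟩ <;> intros <;> omega)
    (by simp [Fin.forall_fin_succ])

/-- The semigroup `⟨4, 5, 6⟩`. -/
def semigroup_4_5_6 : NumericalSemigroup :=
  ofGens ![4, 5, 6] 8 4 (by norm_num) ⟨![1, 0, 0], rfl⟩ (by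
    intro s h1 h2
    interval_cases s
    · exact ⟨![2, 0, 0], rfl⟩
    · exact ⟨![1, 1, 0], rfl⟩
    · exact ⟨![1, 0, 1], rfl⟩
    · exact ⟨![0, 1, 1], rfl⟩)

lemma nonempty_generators_semigroup_4_5_6 :
    Nonempty (Generators semigroup_4_5_6 ![4, 5, 6]) :=
  nonempty_generators_ofGens (by simp [Fin.forall_fin_succ])
    (by
      simp only [Fin.forall_fin_succ, Fin.sum_univ_succ]
      simp
      refine ⟨?_, ?_, ?_⟩ <;> intros <;> omega)
    (by simp [Fin.forall_fin_succ])

/-- The semigroup `⟨8, 10, 15⟩`. -/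
def semigroup_8_10_15 : NumericalSemigroup :=
  ofGens ![8, 10, 15] 38 8 (by norm_num) ⟨![1, 0, 0], rfl⟩ (by
    intro s h1 h2
    interval_cases s
    · exact ⟨![1, 3, 0], rfl⟩
    · exact ⟨![3, 0, 1], rfl⟩
    · exact ⟨![5, 0, 0], rfl⟩
    · exact ⟨![2, 1, 1], rfl⟩
    · exact ⟨![4, 1, 0], rfl⟩
    · exact ⟨![1, 2, 1], rfl⟩
    · exact ⟨![3, 2, 0], rfl⟩
    · exact ⟨![0, 3, 1], rfl⟩)

lemma nonempty_generators_semigroup_8_10_15 :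
    Nonempty (Generators semigroup_8_10_15 ![8, 10, 15]) :=
  nonempty_generators_ofGens (by simp [Fin.forall_fin_succ])
    (by
      simp only [Fin.forall_fin_succ, Fin.sum_univ_succ]
      simp
      refine ⟨?_, ?_, ?_⟩ <;> intros <;> omega)
    (by simp [Fin.forall_fin_succ])

/-- The semigroup `⟨8, 10, 11, 12⟩`. -/
def semigroup_8_10_11_12 : NumericalSemigroup :=
  ofGens ![8, 10, 11, 12] 26 8 (by norm_num) ⟨![1, 0, 0, 0], rfl⟩ (by
    intro s h1 h2
    interval_cases s
    · exact ⟨![2, 1, 0, 0], rfl⟩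
    · exact ⟨![2, 0, 1, 0], rfl⟩
    · exact ⟨![2, 0, 0, 1], rfl⟩
    · exact ⟨![1, 1, 1, 0], rfl⟩
    · exact ⟨![1, 1, 0, 1], rfl⟩
    · exact ⟨![1, 0, 1, 1], rfl⟩
    · exact ⟨![4, 0, 0, 0], rfl⟩
    · exact ⟨![0, 1, 1, 1], rfl⟩)

lemma nonempty_generators_semigroup_8_10_11_12 :
    Nonempty (Generators semigroup_8_10_11_12 ![8, 10, 11, 12]) :=
  nonempty_generators_ofGens (by simp [Fin.forall_fin_succ])
    (by
      simp only [Fin.forall_fin_succ, Fin.sum_univ_succ]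
      simp
      refine ⟨?_, ?_, ?_, ?_⟩ <;> intros <;> omega)
    (by simp [Fin.forall_fin_succ])

/-- The semigroup `⟨5, 6, 9⟩`. -/
def semigroup_5_6_9 : NumericalSemigroup :=
  ofGens ![5, 6, 9] 14 5 (by norm_num) ⟨![1, 0, 0], rfl⟩ (by
    intro s h1 h2
    interval_cases s
    · exact ⟨![1, 0, 1], rfl⟩
    · exact ⟨![3, 0, 0], rfl⟩
    · exact ⟨![2, 1, 0], rfl⟩
    · exact ⟨![1, 2, 0], rfl⟩
    · exact ⟨![0, 3, 0], rfl⟩)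

lemma nonempty_generators_semigroup_5_6_9 :
    Nonempty (Generators semigroup_5_6_9 ![5, 6, 9]) :=
  nonempty_generators_ofGens (by simp [Fin.forall_fin_succ])
    (by
      simp only [Fin.forall_fin_succ, Fin.sum_univ_succ]
      simp
      refine ⟨?_, ?_, ?_⟩ <;> intros <;> omega)
    (by simp [Fin.forall_fin_succ])

/-- The semigroup `⟨10, 14, 15, 21⟩`. -/
def semigroup_10_14_15_21 : NumericalSemigroup :=
  ofGens ![10, 14, 15, 21] 48 10 (by norm_num) ⟨![1, 0, 0, 0], rfl⟩ (by
    intro s h1 h2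
    interval_cases s
    · exact ⟨![2, 2, 0, 0], rfl⟩
    · exact ⟨![2, 1, 1, 0], rfl⟩
    · exact ⟨![5, 0, 0, 0], rfl⟩
    · exact ⟨![3, 0, 0, 1], rfl⟩
    · exact ⟨![1, 3, 0, 0], rfl⟩
    · exact ⟨![1, 2, 1, 0], rfl⟩
    · exact ⟨![4, 1, 0, 0], rfl⟩
    · exact ⟨![4, 0, 1, 0], rfl⟩
    · exact ⟨![2, 0, 1, 1], rfl⟩
    · exact ⟨![0, 3, 1, 0], rfl⟩)

lemma nonempty_generators_semigroup_10_14_15_21 :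
    Nonempty (Generators semigroup_10_14_15_21 ![10, 14, 15, 21]) :=
  nonempty_generators_ofGens (by simp [Fin.forall_fin_succ])
    (by
      simp only [Fin.forall_fin_succ, Fin.sum_univ_succ]
      simp
      refine ⟨?_, ?_, ?_, ?_⟩ <;> intros <;> omega)
    (by simp [Fin.forall_fin_succ])

end NumericalSemigroup

/-! ### Strictness of the implications -/

namespace NumericalSemigroup

lemma isTelescopic_semigroup_4_6_7 : semigroup_4_6_7.IsTelescopic := by
  obtain ⟨G⟩ := nonempty_generators_semigroup_4_6_7
  refine (apery_subset_box_tau _).antisymm (G.box_subset_apery ![0, 1, 1] ?_ ?_)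
  · simp only [Fin.forall_fin_succ]
    refine ⟨by simp, fun _ => G.tau_le ![3, 0, 0] rfl ?_, fun _ => G.tau_le ![2, 1, 0] rfl ?_,
      by simp⟩ <;>
      simp [Fin.forall_fin_succ]
  · intro x y
    simp [Fin.forall_fin_succ, Fin.sum_univ_succ]
    omega

lemma isAlphaRectangular_semigroup_4_6_7 : semigroup_4_6_7.IsAlphaRectangular := by
  obtain ⟨G⟩ := nonempty_generators_semigroup_4_6_7
  refine (apery_subset_box_alpha _).antisymm (G.box_subset_apery ![0, 1, 1] ?_ ?_)
  · simp only [Fin.forall_fin_succ]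
    exact ⟨by simp, fun _ => G.alpha_le ![2, 0, 0] rfl, fun _ => G.alpha_le ![1, 1, 0] rfl, by simp⟩
  · intro x y
    simp [Fin.forall_fin_succ, Fin.sum_univ_succ]
    omega

/-- Here `τ_6 ≥ 1`, and `2 · 6` already exceeds `7`. -/
lemma not_isPlaneBranch_semigroup_4_6_7 : ¬ semigroup_4_6_7.IsPlaneBranch := by
  obtain ⟨G⟩ := nonempty_generators_semigroup_4_6_7
  intro h
  have h1 := h.tau_add_one_mul_lt (G.mem_minGens 1) (G.mem_minGens 2)
    (G.ne_multiplicity (by simp)) (by simp)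
  have h2 : 1 ≤ semigroup_4_6_7.tau (![4, 6, 7] 1) := G.le_tau (by simp) (by
    intro h x h0 hc
    simp [Fin.forall_fin_succ, Fin.sum_univ_succ]
    omega)
  simp at h1 h2
  omega

/-- The critical degrees `3 · 4 = 2 · 6` and `2 · 7 = 2 · 4 + 6` differ. -/
lemma not_hasUniqueBettiElement_semigroup_4_6_7 (k : Type*) [Field k] :
    ¬ semigroup_4_6_7.HasUniqueBettiElement k := by
  obtain ⟨G⟩ := nonempty_generators_semigroup_4_6_7
  intro h
  have h0 := G.isCritical (i := 0) (c := 3) (by norm_num) ![0, 2, 0] rfl rfl (by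
    intro h x h0 hc
    simp [Fin.sum_univ_succ]
    omega)
  have h2 := G.isCritical (i := 2) (c := 2) (by norm_num) ![2, 1, 0] rfl rfl (by
    intro h x h0 hc
    simp [Fin.sum_univ_succ]
    omega)
  have := h.critical_eq h0 h2
  simp [G.coe_toEquiv] at this

lemma isAlphaRectangular_semigroup_4_5_6 : semigroup_4_5_6.IsAlphaRectangular := by
  obtain ⟨G⟩ := nonempty_generators_semigroup_4_5_6
  refine (apery_subset_box_alpha _).antisymm (G.box_subset_apery ![0, 1, 1] ?_ ?_)
  · simp only [Fin.forall_fin_succ]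
    exact ⟨by simp, fun _ => G.alpha_le ![0, 0, 1] rfl, fun _ => G.alpha_le ![2, 0, 0] rfl, by simp⟩
  · intro x y
    simp [Fin.forall_fin_succ, Fin.sum_univ_succ]
    omega

/-- The `τ`-box only sees `⟨4⟩` below `5`, so it contains `2 · 5`, while `2 · 5 = 4 + 6` is not an
Apéry element. -/
lemma not_isTelescopic_semigroup_4_5_6 : ¬ semigroup_4_5_6.IsTelescopic := by
  obtain ⟨G⟩ := nonempty_generators_semigroup_4_5_6
  refine G.apery_ne_box ![0, 2, 0] ![0, 0, 1] rfl ?_ rfl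
  simp only [Fin.forall_fin_succ]
  refine ⟨by simp, fun _ => G.le_tau (by simp) ?_, by simp, by simp⟩
  intro h x h0 hc
  simp [Fin.forall_fin_succ, Fin.sum_univ_succ] at hc ⊢
  omega

lemma isTelescopic_semigroup_8_10_15 : semigroup_8_10_15.IsTelescopic := by
  obtain ⟨G⟩ := nonempty_generators_semigroup_8_10_15
  refine (apery_subset_box_tau _).antisymm (G.box_subset_apery ![0, 3, 1] ?_ ?_)
  · simp only [Fin.forall_fin_succ]
    refine ⟨by simp, fun _ => G.tau_le ![5, 0, 0] rfl ?_, fun _ => G.tau_le ![0, 3, 0] rfl ?_,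
      by simp⟩ <;>
      simp [Fin.forall_fin_succ]
  · intro x y
    simp [Fin.forall_fin_succ, Fin.sum_univ_succ]
    omega

/-- The Apéry element `2 · 15` makes `α_15 ≥ 2`, but `10 + 2 · 15 = 5 · 8`. -/
lemma not_isAlphaRectangular_semigroup_8_10_15 : ¬ semigroup_8_10_15.IsAlphaRectangular := by
  obtain ⟨G⟩ := nonempty_generators_semigroup_8_10_15
  refine G.apery_ne_box ![0, 1, 2] ![4, 0, 0] rfl ?_ rfl
  simp only [Fin.forall_fin_succ]
  refine ⟨by simp, fun _ => G.le_alpha ?_, fun _ => G.le_alpha ?_, by simp⟩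
  all_goals
    intro x
    simp [Fin.sum_univ_succ]
    omega

lemma isGammaRectangular_semigroup_8_10_11_12 : semigroup_8_10_11_12.IsGammaRectangular := by
  obtain ⟨G⟩ := nonempty_generators_semigroup_8_10_11_12
  refine (apery_subset_box_gamma _).antisymm (G.box_subset_apery ![0, 1, 1, 1] ?_ ?_)
  · simp only [Fin.forall_fin_succ]
    exact ⟨by simp, fun _ => G.gamma_le ![1, 0, 0, 1] rfl le_rfl (by simp),
      fun _ => G.gamma_le ![0, 1, 0, 1] rfl le_rfl (by simp),
      fun _ => G.gamma_le ![3, 0, 0, 0] rfl (by simp [Fin.sum_univ_succ]) (by simp), by simp⟩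
  · intro x y
    simp [Fin.forall_fin_succ, Fin.sum_univ_succ]
    omega

/-- The element `2 · 11 = 10 + 12` is in the Apéry set and has order `2`, with two maximal
representations, so it counts for `β` and not for `γ`. But `10 + 2 · 11 = 4 · 8`. -/
lemma not_isBetaRectangular_semigroup_8_10_11_12 : ¬ semigroup_8_10_11_12.IsBetaRectangular := by
  obtain ⟨G⟩ := nonempty_generators_semigroup_8_10_11_12
  refine G.apery_ne_box ![0, 1, 2, 0] ![3, 0, 0, 0] rfl ?_ rfl
  simp only [Fin.forall_fin_succ]
  refine ⟨by simp, fun _ => G.le_beta ?_ ?_, fun _ => G.le_beta ?_ ?_, by simp, by simp⟩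
  all_goals
    intro x
    simp [Fin.sum_univ_succ]
    omega

/-- The `γ`-box contains `2 · 6 + 9 = 3 · 5 + 6`. -/
lemma not_isGammaRectangular_semigroup_5_6_9 : ¬ semigroup_5_6_9.IsGammaRectangular := by
  obtain ⟨G⟩ := nonempty_generators_semigroup_5_6_9
  refine G.apery_ne_box ![0, 2, 1] ![2, 1, 0] rfl ?_ rfl
  simp only [Fin.forall_fin_succ]
  refine ⟨by simp, fun _ => G.le_gamma ?_ ?_, fun _ => G.le_gamma ?_ ?_, by simp⟩
  · intro x
    simp [Fin.sum_univ_succ]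
    omega
  · intro x
    simp [Fin.sum_univ_succ, funext_iff, Fin.forall_fin_succ]
    omega
  · intro x
    simp [Fin.sum_univ_succ]
    omega
  · intro x
    simp [Fin.sum_univ_succ, funext_iff, Fin.forall_fin_succ]
    omega

lemma isFree_semigroup_5_6_9 : semigroup_5_6_9.IsFree := by
  obtain ⟨G⟩ := nonempty_generators_semigroup_5_6_9
  -- Indices are read modulo `3`, which gives the order `6, 9, 5`. In it `2 · 9 = 3 · 6` and `3 · 5
  -- = 6 + 9`.
  set n : ℕ → ℕ := fun i => (![5, 6, 9] : Fin 3 → ℕ) (Fin.ofNat 3 i) with hn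
  have hd : semigroup_5_6_9.embDim = 3 := G.embDim_eq
  have h1 : n 1 = 6 := rfl
  have h2 : n 2 = 9 := rfl
  have h3 : n 3 = 5 := rfl
  have hbij : Set.BijOn n (Set.Icc 1 semigroup_5_6_9.embDim) semigroup_5_6_9.minGens := by
    rw [hd]
    refine ⟨fun i _ => G.mem_minGens _, ?_, fun g hg => ?_⟩
    · rintro i ⟨hi1, hi2⟩ j ⟨hj1, hj2⟩ hij
      interval_cases i <;> interval_cases j <;> simp [h1, h2, h3] at hij ⊢
    · obtain ⟨i, rfl⟩ := G.exists_eq_of_mem_minGens hg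
      fin_cases i
      · exact ⟨3, by simp, h3⟩
      · exact ⟨1, by simp, h1⟩
      · exact ⟨2, by simp, h2⟩
  have hmem : ∀ {i j}, 1 ≤ j → j < i → n j ∈ AddSubmonoid.closure (n '' Set.Ico 1 i) :=
    fun hj hji => AddSubmonoid.subset_closure ⟨_, ⟨hj, hji⟩, rfl⟩
  have hphi2 : phi n 2 ≤ 1 := phi_le (by
    rw [show (1 + 1) * n 2 = 3 * n 1 from rfl]
    exact nsmul_mem (hmem le_rfl (by norm_num)) 3)
  have hphi3 : phi n 3 ≤ 2 := phi_le (by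
    rw [show (2 + 1) * n 3 = n 1 + n 2 from rfl]
    exact add_mem (hmem le_rfl (by norm_num)) (hmem (by norm_num) (by norm_num)))
  refine ⟨n, hbij, (aperyAt_subset_phi_box hbij).antisymm ?_⟩
  rintro s ⟨l, hl, rfl⟩
  rw [hd] at hl ⊢
  have hl2 := (hl 2 (by simp)).trans hphi2
  have hl3 := (hl 3 (by simp)).trans hphi3
  have hsum : ∑ i ∈ Finset.Icc 2 3, l i * n i =
      ∑ i, (![l 3, 0, l 2] : Fin 3 → ℕ) i * (![5, 6, 9] : Fin 3 → ℕ) i := by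
    rw [Finset.sum_Icc_succ_top (by norm_num), Finset.Icc_self, Finset.sum_singleton, h2, h3]
    simp [Fin.sum_univ_succ, add_comm]
  rw [hsum, h1]
  refine G.mem_aperyAt _ fun x => ?_
  simp [Fin.sum_univ_succ]
  omega

/-- Each generator is in the group generated by the others, through `14 + 21 = 2 · 10 + 15` and, for
`10`, through `10 + 14 + 21 = 3 · 15`. None of them can come last. -/
lemma not_isFree_semigroup_10_14_15_21 : ¬ semigroup_10_14_15_21.IsFree := by
  obtain ⟨G⟩ := nonempty_generators_semigroup_10_14_15_21
  intro h
  have hd : semigroup_10_14_15_21.embDim = 4 := G.embDim_eq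
  obtain ⟨g, hg⟩ := h.exists_forall_eval_add_ne (by rw [hd]; norm_num)
  obtain ⟨i, rfl⟩ := G.toEquiv.surjective g
  have key : ∀ x y : Fin 4 → ℕ, x i = 0 → y i = 0 →
      ∑ j, x j * ![10, 14, 15, 21] j + ![10, 14, 15, 21] i ≠ ∑ j, y j * ![10, 14, 15, 21] j := by
    intro x y hx hy
    have := hg (G.vec x) (G.vec y) (by rwa [G.vec_apply]) (by rwa [G.vec_apply])
    rwa [G.eval_vec, G.eval_vec, G.coe_toEquiv] at this
  fin_cases i
  · exact key ![0, 1, 0, 1] ![0, 0, 3, 0] rfl rfl rfl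
  · exact key ![0, 0, 0, 1] ![2, 0, 1, 0] rfl rfl rfl
  · exact key ![2, 0, 0, 0] ![0, 1, 0, 1] rfl rfl rfl
  · exact key ![0, 1, 0, 0] ![2, 0, 1, 0] rfl rfl rfl

lemma isCompleteIntersection_semigroup_10_14_15_21 :
    semigroup_10_14_15_21.IsCompleteIntersection := by
  obtain ⟨G⟩ := nonempty_generators_semigroup_10_14_15_21
  have hd : semigroup_10_14_15_21.embDim = 4 := G.embDim_eq
  set ρ : Set ((semigroup_10_14_15_21.minGens →₀ ℕ) × (semigroup_10_14_15_21.minGens →₀ ℕ)) :=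
    {(G.vec ![0, 0, 2, 0], G.vec ![3, 0, 0, 0]), (G.vec ![0, 3, 0, 0], G.vec ![0, 0, 0, 2]),
      (G.vec ![0, 1, 0, 1], G.vec ![2, 0, 1, 0])} with hρ
  set C := addConGen (fun a b => (a, b) ∈ ρ) with hC
  have h1 : C (G.vec ![0, 0, 2, 0]) (G.vec ![3, 0, 0, 0]) := AddConGen.Rel.of _ _ (by simp [hρ])
  have h2 : C (G.vec ![0, 3, 0, 0]) (G.vec ![0, 0, 0, 2]) := AddConGen.Rel.of _ _ (by simp [hρ])
  have h3 : C (G.vec ![0, 1, 0, 1]) (G.vec ![2, 0, 1, 0]) := AddConGen.Rel.of _ _ (by simp [hρ])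
  -- A consequence of the other two, needed to bound the exponent of `21`: `3 · 21 = 3 · 14 + 21 =
  -- (2 · 10 + 15) + 2 · 14`.
  have h4 : C (G.vec ![0, 0, 0, 3]) (G.vec ![2, 2, 1, 0]) := by
    have e1 : G.vec ![0, 0, 0, 3] = G.vec ![0, 0, 0, 2] + G.vec ![0, 0, 0, 1] := by
      rw [← G.vec_add]; simp
    have e2 : G.vec ![0, 3, 0, 0] + G.vec ![0, 0, 0, 1] =
        G.vec ![0, 1, 0, 1] + G.vec ![0, 2, 0, 0] := by
      rw [← G.vec_add, ← G.vec_add]; simp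
    have e3 : G.vec ![2, 2, 1, 0] = G.vec ![2, 0, 1, 0] + G.vec ![0, 2, 0, 0] := by
      rw [← G.vec_add]; simp
    rw [e1, e3]
    refine C.trans (C.add (C.symm h2) (C.refl _)) ?_
    rw [e2]
    exact C.add h3 (C.refl _)
  -- With the exponent of `10` equal to zero there are ten such vectors, and their values represent
  -- each residue modulo `10` once.
  set N : Set (semigroup_10_14_15_21.minGens →₀ ℕ) := G.vec '' {x : Fin 4 → ℕ |
    x 1 ≤ 2 ∧ x 2 ≤ 1 ∧ x 3 ≤ 2 ∧ (x 1 = 0 ∨ x 3 = 0)} with hN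
  have hpres : semigroup_10_14_15_21.IsPresentation ρ := by
    refine isPresentation_of_normalForms (N := N) ?_ ?_ fun a => ?_
    · rintro p (rfl | rfl | rfl) <;> change eval _ _ = eval _ _ <;>
        rw [G.eval_vec, G.eval_vec] <;> rfl
    · rintro _ ⟨x, hx, rfl⟩ _ ⟨y, hy, rfl⟩ hxy
      rw [G.eval_vec, G.eval_vec] at hxy
      simp only [Set.mem_ofPred_eq] at hx hy
      simp [Fin.sum_univ_succ] at hxy
      congr 1
      simp only [funext_iff, Fin.forall_fin_succ]
      simp
      obtain ⟨hx1, hx2, hx3, hx4⟩ := hx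
      obtain ⟨hy1, hy2, hy3, hy4⟩ := hy
      have hx2' : x 2 = 0 ∨ x 2 = 1 := by omega
      have hy2' : y 2 = 0 ∨ y 2 = 1 := by omega
      have hx1' : x 1 = 0 ∨ x 1 = 1 ∨ x 1 = 2 := by omega
      have hy1' : y 1 = 0 ∨ y 1 = 1 ∨ y 1 = 2 := by omega
      rcases hx2' with h | h <;> rcases hy2' with h' | h' <;> rcases hx1' with h'' | h'' | h'' <;>
        rcases hy1' with h''' | h''' | h''' <;> omega
    · obtain ⟨x, rfl⟩ := G.exists_vec_eq a
      -- The weights `0, 5, 1, 5` are chosen so that all four rewritings `h1`, `h2`, `h3`, `h4`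
      -- strictly decrease the total.
      have hstep : ∀ (x u v : Fin 4 → ℕ), u ≤ x → C (G.vec u) (G.vec v) →
          5 * v 1 + v 2 + 5 * v 3 < 5 * u 1 + u 2 + 5 * u 3 →
          ∃ y : Fin 4 → ℕ, 5 * y 1 + y 2 + 5 * y 3 < 5 * x 1 + x 2 + 5 * x 3 ∧
            C (G.vec x) (G.vec y) := by
        intro x u v hu huv hlt
        obtain ⟨r, rfl⟩ := exists_add_of_le hu
        refine ⟨v + r, ?_, ?_⟩
        · simp only [Pi.add_apply]; omega
        · rw [G.vec_add, G.vec_add]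
          exact C.add huv (C.refl _)
      induction hw : 5 * x 1 + x 2 + 5 * x 3 using Nat.strong_induction_on generalizing x with
      | _ w ih =>
        by_cases hx : x 1 ≤ 2 ∧ x 2 ≤ 1 ∧ x 3 ≤ 2 ∧ (x 1 = 0 ∨ x 3 = 0)
        · exact ⟨_, ⟨x, hx, rfl⟩, C.refl _⟩
        · have : ∃ y : Fin 4 → ℕ, 5 * y 1 + y 2 + 5 * y 3 < 5 * x 1 + x 2 + 5 * x 3 ∧
              C (G.vec x) (G.vec y) := by
            by_cases hx2 : 2 ≤ x 2
            · exact hstep x _ _ (by simp [Pi.le_def, Fin.forall_fin_succ]; omega) h1 (by simp)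
            by_cases hx1 : 3 ≤ x 1
            · exact hstep x _ _ (by simp [Pi.le_def, Fin.forall_fin_succ]; omega) h2 (by simp)
            by_cases hx3 : 3 ≤ x 3
            · exact hstep x _ _ (by simp [Pi.le_def, Fin.forall_fin_succ]; omega) h4 (by simp)
            · exact hstep x _ _ (by simp [Pi.le_def, Fin.forall_fin_succ]; omega) h3 (by simp)
          obtain ⟨y, hy, hxy⟩ := this
          obtain ⟨b, hb, hyb⟩ := ih _ (hw ▸ hy) y rfl
          exact ⟨b, hb, C.trans hxy hyb⟩
  refine hpres.isCompleteIntersection ?_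
  have h3 : ρ.encard ≤ 3 := by
    calc ρ.encard ≤ 1 + 1 + 1 := by
          refine (Set.encard_insert_le _ _).trans (add_le_add ?_ le_rfl)
          refine (Set.encard_insert_le _ _).trans (add_le_add ?_ le_rfl)
          rw [Set.encard_singleton]
      _ = 3 := by norm_num
  rw [hd]
  calc ρ.encard + 1 ≤ 3 + 1 := add_le_add h3 le_rfl
    _ = ((4 : ℕ) : ℕ∞) := by norm_num

end NumericalSemigroup

theorem theorem1p9 (k : Type*) [Field k] :
    -- the implications
    (∀ S : NumericalSemigroup,
      (S.IsPlaneBranch → S.IsTelescopic) ∧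
      (S.IsTelescopic → S.IsBetaRectangular) ∧
      (S.HasUniqueBettiElement k → S.IsAlphaRectangular) ∧
      (S.IsAlphaRectangular → S.IsBetaRectangular) ∧
      (S.IsPlaneBranch → S.IsAlphaRectangular) ∧
      (S.HasUniqueBettiElement k → S.IsTelescopic) ∧
      (S.IsBetaRectangular → S.IsGammaRectangular) ∧
      (S.IsGammaRectangular → S.IsFree) ∧
      (S.IsFree → S.IsCompleteIntersection)) ∧
    -- none of them can be reversed
    (∃ S : NumericalSemigroup, S.IsTelescopic ∧ ¬ S.IsPlaneBranch) ∧
    (∃ S : NumericalSemigroup, S.IsBetaRectangular ∧ ¬ S.IsTelescopic) ∧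
    (∃ S : NumericalSemigroup, S.IsAlphaRectangular ∧ ¬ S.HasUniqueBettiElement k) ∧
    (∃ S : NumericalSemigroup, S.IsBetaRectangular ∧ ¬ S.IsAlphaRectangular) ∧
    (∃ S : NumericalSemigroup, S.IsAlphaRectangular ∧ ¬ S.IsPlaneBranch) ∧
    (∃ S : NumericalSemigroup, S.IsTelescopic ∧ ¬ S.HasUniqueBettiElement k) ∧
    (∃ S : NumericalSemigroup, S.IsGammaRectangular ∧ ¬ S.IsBetaRectangular) ∧
    (∃ S : NumericalSemigroup, S.IsFree ∧ ¬ S.IsGammaRectangular) ∧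
    (∃ S : NumericalSemigroup, S.IsCompleteIntersection ∧ ¬ S.IsFree) := by
  exact ⟨fun _ => ⟨fun h => h.1, fun h => h.isBetaRectangular, fun h => h.isAlphaRectangular,
      fun h => h.isBetaRectangular, fun h => h.isAlphaRectangular, fun h => h.isTelescopic,
      fun h => h.isGammaRectangular, fun h => h.isFree, fun h => h.isCompleteIntersection⟩,
    ⟨_, NumericalSemigroup.isTelescopic_semigroup_4_6_7,
      NumericalSemigroup.not_isPlaneBranch_semigroup_4_6_7⟩,
    ⟨_, NumericalSemigroup.isAlphaRectangular_semigroup_4_5_6.isBetaRectangular,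
      NumericalSemigroup.not_isTelescopic_semigroup_4_5_6⟩,
    ⟨_, NumericalSemigroup.isAlphaRectangular_semigroup_4_6_7,
      NumericalSemigroup.not_hasUniqueBettiElement_semigroup_4_6_7 k⟩,
    ⟨_, NumericalSemigroup.isTelescopic_semigroup_8_10_15.isBetaRectangular,
      NumericalSemigroup.not_isAlphaRectangular_semigroup_8_10_15⟩,
    ⟨_, NumericalSemigroup.isAlphaRectangular_semigroup_4_6_7,
      NumericalSemigroup.not_isPlaneBranch_semigroup_4_6_7⟩,
    ⟨_, NumericalSemigroup.isTelescopic_semigroup_4_6_7,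
      NumericalSemigroup.not_hasUniqueBettiElement_semigroup_4_6_7 k⟩,
    ⟨_, NumericalSemigroup.isGammaRectangular_semigroup_8_10_11_12,
      NumericalSemigroup.not_isBetaRectangular_semigroup_8_10_11_12⟩,
    ⟨_, NumericalSemigroup.isFree_semigroup_5_6_9,
      NumericalSemigroup.not_isGammaRectangular_semigroup_5_6_9⟩,
    ⟨_, NumericalSemigroup.isCompleteIntersection_semigroup_10_14_15_21,
      NumericalSemigroup.not_isFree_semigroup_10_14_15_21⟩⟩
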